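/- Let $\mathcal A=\{A_1,\dots,A_m\}$ be a set of $m\ge 1$ distinct real $n\times n$ matrices, none of which is a Barabanov matrix, where $A$ is called Barabanov if $A^\top PA=\gamma^2P$ for some symmetric $P\succ 0$ and some $\gamma\ge 0$. Let $\mathbb S$ be the Euclidean unit sphere of $\mathbb R^n$, let $\Delta=\mathcal A\times\mathbb S$, and let $\mathbb P$ be the uniform distribution on $\Delta$ (the product of the uniform distributions on $\mathcal A$ and on $\mathbb S$). Fix $C\ge n$. For a finite set $\omega\subseteq\Delta$ let $\mathcal P_{\mathrm{jsr}}(\omega)$ be the problem of minimizing $(\gamma,\|P\|_F^2)$ in the lexicographical order (first component first) over all $\gamma\ge 0$ and all symmetric $P\in\mathbb R^{n\times n}$ with $P\succeq I$ and $\|P\|_F\le C$ such that $$(Ax)^\top P(Ax)\le\gamma^2\,x^\top Px\qquad\text{for all }(A,x)\in\omega .$$ For $a,b>0$ and $x\in[0,1]$ let $I(x;a;b)=\frac{1}{B(a,b)}\int_0^x t^{a-1}(1-t)^{b-1}\,dt$ be the regularized incomplete beta function, let $I^{-1}(\,\cdot\,;a;b):[0,1]\to[0,1]$ be the inverse of $x\mapsto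 I(x;a;b)$, and let $\Phi(\varepsilon,q,N)=I(1-\varepsilon;N-q;q+1)=\sum_{i=0}^{q}\binom Ni\varepsilon^i(1-\varepsilon)^{N-i}$. For symmetric $P\succ0$ let $\kappa(P)=\sqrt{\det(P)/\lambda_{\min}(P)^n}$. Let $\rho(\mathcal A)=\lim_{k\to\infty}\max\{\|B_1\cdots B_k\|^{1/k}:B_1,\dots,B_k\in\mathcal A\}$ be the joint spectral radius of $\mathcal A$. Let $d=\frac{n(n+1)}2$, let $N\in\mathbb N$ with $N\ge d$, and let $\varepsilon\in(0,1)$. For every $\bar\omega_N=(\delta_1,\dots,\delta_N)\in\Delta^N$, with underlying set $\omega_N=\{\delta_1,\dots,\delta_N\}$, the problem $\mathcal P_{\mathrm{jsr}}(\omega_N)$ has a unique optimal solution $(\gamma^*,P^*)$. Moreover, there is a measurable set $\Omega\subseteq\Delta^N$ with $\mathbb P^N(\Omega)\le\Phi(\varepsilon,d-1,N)$ such that, for all $\bar\omega_N\in\Delta^N\setminus\Omega$, if $m\,\varepsilon\,\kappa(P^*)<1$, then $$\rho(\mathcal A)\;\le\;\frac{\gamma^*}{\sqrt{1-I^{-1}\!\Big(m\,\varepsilon\,\kappa(P^*);\frac{d-1}2;\frac12\Big)}}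 .$$ (If $m\,\varepsilon\,\kappa(P^*)\ge1$, the right-hand side is read as $+\infty$ and nothing is claimed.) -/

import Mathlib

open MeasureTheory Filter

noncomputable section

namespace JSR

/-! ### Incomplete beta functions -/

/-- The regularized incomplete beta function
`I(x; a, b) = (∫₀ˣ t^(a-1) (1-t)^(b-1) dt) / B(a, b)`, for `0 ≤ x ≤ 1` and `a, b > 0`. -/
def regIncBeta (x a b : ℝ) : ℝ :=
  (∫ t in (0 : ℝ)..x, t ^ (a - 1) * (1 - t) ^ (b - 1)) / ProbabilityTheory.beta a b

/-- The inverse `I⁻¹(y; a, b)` of the increasing bijection `x ↦ I(x; a, b)` of `[0, 1]`: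
for `0 ≤ y ≤ 1` and `a, b > 0`, the unique `x ∈ [0, 1]` with `I(x; a, b) = y`. -/
def regIncBetaInv (y a b : ℝ) : ℝ :=
  Function.invFunOn (fun x => regIncBeta x a b) (Set.Icc 0 1) y

/-- `Φ(ε, q, N) = I(1 - ε; N - q, q + 1)`, which for integers `0 ≤ q < N` is the binomial tail
`∑_{i ≤ q} (N choose i) ε^i (1 - ε)^(N - i)`. -/
def Phi (ε : ℝ) (q N : ℕ) : ℝ :=
  regIncBeta (1 - ε) ((N : ℝ) - q) ((q : ℝ) + 1)

/-! ### Barabanov matrices and the joint spectral radius -/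

variable {n : ℕ}

/-- `A` is Barabanov if `Aᵀ P A = γ² P` for some symmetric `P ≻ 0` and some `γ ≥ 0`. -/
def IsBarabanov (A : Matrix (Fin n) (Fin n) ℝ) : Prop :=
  ∃ P : Matrix (Fin n) (Fin n) ℝ, P.PosDef ∧ ∃ γ : ℝ, 0 ≤ γ ∧ A.transpose * P * A = γ ^ 2 • P

/-- The largest Euclidean operator norm of a product of `k` matrices of `𝒜`
(a maximum over the finitely many words of length `k`). -/
def maxProdNorm (𝒜 : Finset (Matrix (Fin n) (Fin n) ℝ)) (k : ℕ) : ℝ :=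
  ⨆ w : Fin k → 𝒜,
    ‖Matrix.toEuclideanCLM (n := Fin n) (𝕜 := ℝ)
      (List.ofFn fun i => (w i : Matrix (Fin n) (Fin n) ℝ)).prod‖

/-- The joint spectral radius
`ρ(𝒜) = lim_{k → ∞} max {‖A₁ ⋯ A_k‖^(1/k) : A₁, …, A_k ∈ 𝒜}`.
The limit exists by submultiplicativity, so that it is the upper limit. -/
def jointSpectralRadius (𝒜 : Finset (Matrix (Fin n) (Fin n) ℝ)) : ℝ :=
  limsup (fun k : ℕ => maxProdNorm 𝒜 k ^ (1 / (k : ℝ))) atTop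

/-! ### The sample space -/

/-- The unit Euclidean sphere of `ℝⁿ`. -/
abbrev Sphere (n : ℕ) : Type :=
  Metric.sphere (0 : EuclideanSpace ℝ (Fin n)) 1

/-- The finite set of modes is a discrete measurable space. -/
instance instMeasurableSpaceModes (𝒜 : Finset (Matrix (Fin n) (Fin n) ℝ)) :
    MeasurableSpace 𝒜 := ⊤

/-- The sample space `Δ = 𝒜 × 𝕊`. -/
abbrev Sample (𝒜 : Finset (Matrix (Fin n) (Fin n) ℝ)) : Type :=
  𝒜 × Sphere n

/-- The uniform distribution on the unit sphere: the normalized surface measure. -/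
def sphereUniform (n : ℕ) : Measure (Sphere n) :=
  ((volume : Measure (EuclideanSpace ℝ (Fin n))).toSphere Set.univ)⁻¹ •
    (volume : Measure (EuclideanSpace ℝ (Fin n))).toSphere

/-- The uniform distribution on `Δ = 𝒜 × 𝕊`. -/
def sampleMeasure (𝒜 : Finset (Matrix (Fin n) (Fin n) ℝ)) : Measure (Sample 𝒜) :=
  (ProbabilityTheory.uniformOn (Set.univ : Set 𝒜)).prod (sphereUniform n)

/-! ### The sampled quadratic Lyapunov problem -/

/-- The quadratic form `vᵀ P v`. -/
def quadForm (P : Matrix (Fin n) (Fin n) ℝ) (v : Fin n → ℝ) : ℝ :=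
  v ⬝ᵥ P.mulVec v

section Frobenius

attribute [local instance] Matrix.frobeniusNormedAddCommGroup

/-- The Frobenius norm of a matrix. -/
def frobeniusNorm (P : Matrix (Fin n) (Fin n) ℝ) : ℝ := ‖P‖

end Frobenius

/-- `(γ, P)` is feasible for the problem with sampled constraints `ω`: `γ ≥ 0`, `P` is symmetric,
`P ⪰ I`, `‖P‖_F ≤ C`, and `(Ax)ᵀ P (Ax) ≤ γ² xᵀ P x` for all `(A, x) ∈ ω`. -/
structure IsFeasible {𝒜 : Finset (Matrix (Fin n) (Fin n) ℝ)} (C : ℝ) (ω : Set (Sample 𝒜))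
    (s : ℝ × Matrix (Fin n) (Fin n) ℝ) : Prop where
  gamma_nonneg : 0 ≤ s.1
  symm : s.2.IsSymm
  one_le : (s.2 - 1).PosSemidef
  norm_le : frobeniusNorm s.2 ≤ C
  sampled : ∀ δ ∈ ω, quadForm s.2 ((δ.1 : Matrix (Fin n) (Fin n) ℝ).mulVec δ.2.1.ofLp) ≤
    s.1 ^ 2 * quadForm s.2 δ.2.1.ofLp

/-- The objective `(γ, ‖P‖_F²)`, with values in the plane with the lexicographical order. -/
def cost (s : ℝ × Matrix (Fin n) (Fin n) ℝ) : ℝ ×ₗ ℝ :=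
  toLex (s.1, frobeniusNorm s.2 ^ 2)

/-- `s = (γ*, P*)` is an optimal solution of the problem with sampled constraints `ω`. -/
def IsOptimal {𝒜 : Finset (Matrix (Fin n) (Fin n) ℝ)} (C : ℝ) (ω : Set (Sample 𝒜))
    (s : ℝ × Matrix (Fin n) (Fin n) ℝ) : Prop :=
  IsFeasible C ω s ∧ ∀ t, IsFeasible C ω t → cost s ≤ cost t

/-- The smallest eigenvalue of a symmetric matrix. -/
def lambdaMin (P : Matrix (Fin n) (Fin n) ℝ) : ℝ := sInf (spectrum ℝ P)

/-- `κ(P) = √(det P / λ_min(P)ⁿ)`. -/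
def kappa (P : Matrix (Fin n) (Fin n) ℝ) : ℝ := √(P.det / lambdaMin P ^ n)

end JSR

end

/-!
The proof has a probabilistic half and a geometric half.

*Scenario bound.* The problem with samples `ω` has a unique optimum: for fixed `γ` the feasible
matrices form a compact convex set, on which `‖P‖_F²` is strictly convex. Three properties of the
optimum matter. A sample whose constraint holds strictly may be dropped without changing it
(`isOptimal_sdiff_of_not_tight`). A given `(γ, P)` is tight for almost no sample
(`sampleMeasure_tight`): otherwise, for some mode `A`, the quadratic form `AᵀPA - γ²P` would vanish
on a set of directions of positive measure, hence identically, and `A` would be Barabanov.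
Finally, at most `d = n (n + 1) / 2` samples suffice to determine the optimum
(`ncard_le_of_irredundant`). This is one less than the number of parameters of `(γ, P)`, and it is
the homogeneity in `P` of the sampled constraints that saves one: a linear relation between `d + 1`
symmetric matrices, not necessarily an affine one, makes two convex combinations of them
proportional, and each sampled constraint is satisfied by one of the two, hence by both.

The event that the optimum satisfies a new constraint with probability less than `1 - ε` is then
bounded in `IsSampledProblem.pi_low_sat_le`. Almost surely the tight samples are the smallest
family that determines the optimum, but they may be fewer than `d`. Independent uniform labels on
the samples complete them, by the samples of smallest labels, to a family of exactly `d`. So one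
`d`-subfamily is selected almost surely, namely the only one that accepts all other samples. Given
a `d`-subfamily, each of the others is accepted independently with the same probability `q`; as
the probabilities of being selected add up to one for every number of samples, all moments of `q`
are known. On the unit interval they determine its distribution (`measure_eq_of_moments_eq`), and
`q ≤ 1 - ε` happens for the selected subfamily with probability `Φ(ε, d - 1, N)`.

*Cap estimate.* Let `(γ, P)` be violated with probability at most `ε`, and write `P = BᵀB`. The
directions that one of the `m` modes, say `A`, violates fill at most the proportion `m ε` of the
ball, so that in the coordinates `B x` they fill at most the proportion `m ε κ(P)`
(`volume_image_cone_le`). A double cap of larger proportion around any direction contains some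
`y` that is not violated, that is, with `‖B A B⁻¹ y‖ ≤ γ ‖y‖`. Choosing the cap around
`(B A B⁻¹)ᵀ v` and pairing `v` with `B A B⁻¹ y` gives
`‖B A B⁻¹‖ ≤ γ / √(1 - I⁻¹(m ε κ(P); (d - 1) / 2, 1 / 2))` (`norm_conj_le_of_cone_small`).
The proportion of a cap is an incomplete beta value with parameter `(n - 1) / 2`, and it decreases
if this is replaced by `(d - 1) / 2` (`volume_cap_ge`). A common bound on the norms of the
`B A B⁻¹` bounds the joint spectral radius (`jointSpectralRadius_le_of_conj`).
-/

namespace JSR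

/-! ### Product measures and sampled families -/

/-- The subfamily of `ω` indexed by the `d`-element set `J`, enumerated increasingly. -/
def subfamily {Z : Type*} {N d : ℕ} (ω : Fin N → Z) (J : {J : Finset (Fin N) // J.card = d}) :
    Fin d → Z :=
  fun i => ω (J.1.orderEmbOfFin J.2 i)

section Product

variable {Z : Type*} [MeasurableSpace Z] (μ : Measure Z) [IsProbabilityMeasure μ]

theorem measurePreserving_pi_split {α β ι : Type*} [Fintype α] [Fintype β] [Fintype ι]
    (e : α ⊕ β ≃ ι) :
    MeasurePreserving
      (fun ω : ι → Z => ((fun a => ω (e (Sum.inl a))), (fun b => ω (e (Sum.inr b)))))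
      (Measure.pi fun _ => μ) ((Measure.pi fun _ : α => μ).prod (Measure.pi fun _ : β => μ)) := by
  have h := (measurePreserving_sumPiEquivProdPi (X := fun _ : α ⊕ β => Z) fun _ => μ).comp
    ((measurePreserving_piCongrLeft (α := fun _ : ι => Z) (fun _ => μ) e).symm)
  exact h

theorem measurable_subfamily {N d : ℕ} (J : {J : Finset (Fin N) // J.card = d}) :
    Measurable fun ω : Fin N → Z => subfamily ω J :=
  measurable_pi_lambda _ fun _ => measurable_pi_apply _

/-- Conditionally on the subfamily indexed by `J`, the other samples are independent: they all
meet a condition `S` depending on that subfamily with probability a power of the conditional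
probability of `S`. -/
theorem pi_subfamily_event {N d : ℕ} (J : {J : Finset (Fin N) // J.card = d})
    {S : Set ((Fin d → Z) × Z)} (hS : MeasurableSet S) {Q : Set (Fin d → Z)}
    (hQ : MeasurableSet Q) :
    Measure.pi (fun _ : Fin N => μ)
        {ω | subfamily ω J ∈ Q ∧ ∀ i ∉ J.1, (subfamily ω J, ω i) ∈ S} =
      ∫⁻ c in Q, μ (Prod.mk c ⁻¹' S) ^ (N - d) ∂(Measure.pi fun _ : Fin d => μ) := by
  obtain ⟨J, hJ⟩ := J
  have hJc : Jᶜ.card = N - d := by rw [Finset.card_compl, hJ, Fintype.card_fin]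
  set e := finSumEquivOfFinset hJ hJc
  have hmp := measurePreserving_pi_split μ e
  let R : Set ((Fin d → Z) × (Fin (N - d) → Z)) := {p | p.1 ∈ Q ∧ ∀ b, (p.1, p.2 b) ∈ S}
  have hR : MeasurableSet R := by
    have : R = (Prod.fst ⁻¹' Q) ∩
        ⋂ b, (fun p : (Fin d → Z) × (Fin (N - d) → Z) => (p.1, p.2 b)) ⁻¹' S := by
      ext p; simp [R]
    rw [this]
    exact (measurable_fst hQ).inter (MeasurableSet.iInter fun b =>
      (measurable_fst.prodMk ((measurable_pi_apply b).comp measurable_snd)) hS)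
  have hset : {ω : Fin N → Z | subfamily ω ⟨J, hJ⟩ ∈ Q ∧
        ∀ i ∉ J, (subfamily ω ⟨J, hJ⟩, ω i) ∈ S} =
      (fun ω : Fin N → Z =>
        ((fun a => ω (e (Sum.inl a))), (fun b => ω (e (Sum.inr b))))) ⁻¹' R := by
    ext ω
    have h1 : (fun a => ω (e (Sum.inl a))) = subfamily ω ⟨J, hJ⟩ := by
      funext a
      simp [e, subfamily]
    simp only [Set.mem_ofPred_eq, Set.mem_preimage, R, h1]
    refine and_congr_right fun _ => ⟨fun h b => h _ ?_, fun h i hi => ?_⟩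
    · have := Finset.orderEmbOfFin_mem Jᶜ hJc b
      simp only [e, finSumEquivOfFinset_inr]
      exact Finset.mem_compl.1 this
    · obtain ⟨b, hb⟩ : i ∈ Set.range (Jᶜ.orderEmbOfFin hJc) := by
        rw [Finset.range_orderEmbOfFin]; simpa using hi
      have := h b
      simp only [e, finSumEquivOfFinset_inr] at this
      rwa [hb] at this
  rw [hset, hmp.measure_preimage hR.nullMeasurableSet, Measure.prod_apply hR,
    ← lintegral_indicator hQ]
  refine lintegral_congr fun c => ?_
  by_cases hc : c ∈ Q
  · have : Prod.mk c ⁻¹' R = Set.univ.pi fun _ => Prod.mk c ⁻¹' S := by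
      ext p; simp [R, hc]
    rw [this, Measure.pi_pi, Set.indicator_of_mem hc]
    simp
  · have : Prod.mk c ⁻¹' R = ∅ := by
      ext p; simp [R, hc]
    rw [this, Set.indicator_of_notMem hc]
    simp

/-- A sample outside `J` almost surely avoids a set that has measure zero whatever the samples
in `J` are. -/
theorem ae_pi_subfamily_notMem {N d : ℕ} (J : {J : Finset (Fin N) // J.card = d})
    {S : Set ((Fin d → Z) × Z)} (hS : MeasurableSet S) (h0 : ∀ c, μ (Prod.mk c ⁻¹' S) = 0) :
    ∀ᵐ ω ∂(Measure.pi fun _ : Fin N => μ), ∀ i ∉ J.1, (subfamily ω J, ω i) ∉ S := by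
  have h := pi_subfamily_event μ J hS.compl MeasurableSet.univ
  have h1 : ∀ c, μ (Prod.mk c ⁻¹' Sᶜ) = 1 := fun c => by
    rw [Set.preimage_compl, prob_compl_eq_one_iff (measurable_prodMk_left hS)]
    exact h0 c
  simp only [h1, one_pow, Set.mem_univ, true_and] at h
  have hm : MeasurableSet {ω : Fin N → Z | ∀ i ∉ J.1, (subfamily ω J, ω i) ∈ Sᶜ} := by
    simp only [Set.ofPred_forall]
    exact MeasurableSet.iInter fun i => MeasurableSet.iInter fun _ =>
      ((measurable_subfamily J).prodMk (measurable_pi_apply i)) hS.compl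
  rw [lintegral_const, Measure.restrict_univ, measure_univ, mul_one] at h
  exact (prob_compl_eq_zero_iff hm).2 h

end Product

/-! ### Moments determine measures on the unit interval -/

/-- Finite measures on `[0, 1]` are determined by their moments, since polynomials are uniformly
dense in the continuous functions. -/
theorem measure_eq_of_moments_eq {μ ν : Measure ℝ} [IsFiniteMeasure μ] [IsFiniteMeasure ν]
    (hμ : ∀ᵐ x ∂μ, x ∈ Set.Icc (0 : ℝ) 1) (hν : ∀ᵐ x ∂ν, x ∈ Set.Icc (0 : ℝ) 1)
    (h : ∀ k : ℕ, ∫ x, x ^ k ∂μ = ∫ x, x ^ k ∂ν) : μ = ν := by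
  have hint : ∀ (ρ : Measure ℝ) [IsFiniteMeasure ρ], (∀ᵐ x ∂ρ, x ∈ Set.Icc (0 : ℝ) 1) →
      ∀ k : ℕ, Integrable (fun x => x ^ k) ρ := by
    intro ρ _ hρ k
    refine Integrable.of_bound (by fun_prop) 1 ?_
    filter_upwards [hρ] with x hx
    rw [Real.norm_eq_abs, abs_of_nonneg (pow_nonneg hx.1 k)]
    exact pow_le_one₀ hx.1 hx.2
  have hpint : ∀ (ρ : Measure ℝ) [IsFiniteMeasure ρ], (∀ᵐ x ∂ρ, x ∈ Set.Icc (0 : ℝ) 1) →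
      ∀ p : Polynomial ℝ, Integrable (fun x => p.eval x) ρ := by
    intro ρ _ hρ p
    simp only [Polynomial.eval_eq_sum_range]
    exact integrable_finsetSum _ fun i _ => (hint ρ hρ i).const_mul _
  have hp : ∀ p : Polynomial ℝ, ∫ x, p.eval x ∂μ = ∫ x, p.eval x ∂ν := by
    intro p
    simp only [Polynomial.eval_eq_sum_range]
    rw [integral_finsetSum _ fun i _ => (hint μ hμ i).const_mul _,
      integral_finsetSum _ fun i _ => (hint ν hν i).const_mul _]
    simp only [integral_const_mul, h]
  refine ext_of_forall_integral_eq_of_IsFiniteMeasure fun f => ?_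
  have key : ∀ (ρ : Measure ℝ) [IsFiniteMeasure ρ], (∀ᵐ x ∂ρ, x ∈ Set.Icc (0 : ℝ) 1) →
      ∀ (η : ℝ) (p : Polynomial ℝ), (∀ x ∈ Set.Icc (0 : ℝ) 1, |p.eval x - f x| < η) →
      |∫ x, p.eval x ∂ρ - ∫ x, f x ∂ρ| ≤ η * ρ.real Set.univ := by
    intro ρ _ hρ η p hpη
    rw [← integral_sub (hpint ρ hρ p) (f.integrable ρ)]
    refine norm_integral_le_of_norm_le_const (μ := ρ) (f := fun x => p.eval x - f x) ?_
    filter_upwards [hρ] with x hx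
    exact (hpη x hx).le
  refine eq_of_forall_dist_le fun η hη => ?_
  rw [Real.dist_eq]
  set M := μ.real Set.univ + ν.real Set.univ + 1
  have hM : 0 < M := by positivity
  obtain ⟨p, hpη⟩ := exists_polynomial_near_of_continuousOn 0 1 f f.continuous.continuousOn
    (η / M) (by positivity)
  have h1 := abs_le.1 (key μ hμ _ p hpη)
  have h2 := abs_le.1 (key ν hν _ p hpη)
  rw [hp p] at h1
  have h3 : η / M * μ.real Set.univ + η / M * ν.real Set.univ + η / M = η := by
    rw [← mul_add, ← mul_add_one]; exact div_mul_cancel₀ _ hM.ne'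
  have h4 : 0 < η / M := by positivity
  rw [abs_le]
  constructor <;> linarith [h1.1, h1.2, h2.1, h2.2]

/-! ### Beta integrals -/

theorem intervalIntegrable_beta {a b : ℝ} (ha : 0 < a) (hb : 0 < b) :
    IntervalIntegrable (fun t : ℝ => t ^ (a - 1) * (1 - t) ^ (b - 1)) volume 0 1 := by
  have h := Complex.betaIntegral_convergent (u := a) (v := b) (by simpa) (by simpa)
  rw [intervalIntegrable_iff_integrableOn_Ioc_of_le zero_le_one] at h ⊢
  refine (h.re).congr ?_
  rw [EventuallyEq, ae_restrict_iff' measurableSet_Ioc]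
  refine Eventually.of_forall fun t ht => ?_
  have h1 : ((t : ℂ) ^ ((a : ℂ) - 1)) = ((t ^ (a - 1) : ℝ) : ℂ) := by
    rw [Complex.ofReal_cpow ht.1.le]; simp
  have h2 : ((1 - (t : ℂ)) ^ ((b : ℂ) - 1)) = (((1 - t) ^ (b - 1) : ℝ) : ℂ) := by
    rw [Complex.ofReal_cpow (sub_nonneg.2 ht.2)]; simp
  simp only [h1, h2, ← Complex.ofReal_mul]
  rfl

theorem integral_beta {a b : ℝ} (ha : 0 < a) (hb : 0 < b) :
    ∫ t in (0 : ℝ)..1, t ^ (a - 1) * (1 - t) ^ (b - 1) = ProbabilityTheory.beta a b := by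
  have hc : Complex.betaIntegral a b =
      ((∫ t in (0 : ℝ)..1, t ^ (a - 1) * (1 - t) ^ (b - 1) : ℝ) : ℂ) := by
    rw [Complex.betaIntegral, ← intervalIntegral.integral_ofReal]
    refine intervalIntegral.integral_congr fun t ht => ?_
    rw [Set.uIcc_of_le zero_le_one] at ht
    have h1 : ((t : ℂ) ^ ((a : ℂ) - 1)) = ((t ^ (a - 1) : ℝ) : ℂ) := by
      rw [Complex.ofReal_cpow ht.1]; simp
    have h2 : ((1 - (t : ℂ)) ^ ((b : ℂ) - 1)) = (((1 - t) ^ (b - 1) : ℝ) : ℂ) := by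
      rw [Complex.ofReal_cpow (sub_nonneg.2 ht.2)]; simp
    simp only [h1, h2, ← Complex.ofReal_mul]
  rw [ProbabilityTheory.beta_eq_betaIntegralReal a b ha hb, hc, Complex.ofReal_re]

theorem choose_mul_beta {d N : ℕ} (hd : 1 ≤ d) (hN : d ≤ N) :
    (N.choose d : ℝ) * d * ProbabilityTheory.beta ((N - d : ℕ) + 1) d = 1 := by
  obtain ⟨e, rfl⟩ : ∃ e, d = e + 1 := ⟨d - 1, by omega⟩
  rw [ProbabilityTheory.beta]
  have h1 : (((N - (e + 1) : ℕ) : ℝ) + 1 + ((e + 1 : ℕ) : ℝ)) = (N : ℝ) + 1 := by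
    rw [Nat.cast_sub hN]; ring
  rw [h1, Real.Gamma_nat_eq_factorial, Real.Gamma_nat_eq_factorial, Nat.cast_add_one,
    Real.Gamma_nat_eq_factorial, ← Nat.choose_mul_factorial_mul_factorial hN]
  push_cast [Nat.factorial_succ]
  have hc : ((N.choose (e + 1) : ℕ) : ℝ) ≠ 0 := by
    exact_mod_cast (Nat.choose_pos hN).ne'
  have hf : (((N - (e + 1)).factorial : ℕ) : ℝ) ≠ 0 := by positivity
  have hf' : ((e.factorial : ℕ) : ℝ) ≠ 0 := by positivity
  field_simp

/-- `Φ(ε, d - 1, N)` as the sum over the `d`-subsets of the probability that an acceptance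
probability of law `minUniform d` is at most `1 - ε` and the other `N - d` samples are accepted. -/
theorem Phi_eq_integral {d N : ℕ} (hd : 1 ≤ d) (hN : d ≤ N) (ε : ℝ) :
    Phi ε (d - 1) N =
      (N.choose d : ℝ) * ∫ t in (0 : ℝ)..(1 - ε), t ^ (N - d) * (d * (1 - t) ^ (d - 1)) := by
  have h1 : ((N : ℝ) - ((d - 1 : ℕ) : ℝ)) = ((N - d : ℕ) : ℝ) + 1 := by
    rw [Nat.cast_sub hN, Nat.cast_sub hd]; push_cast; ring
  have h2 : (((d - 1 : ℕ) : ℝ) + 1) = d := by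
    rw [Nat.cast_sub hd]; push_cast; ring
  have h3 : ((d : ℝ) - 1) = ((d - 1 : ℕ) : ℝ) := by
    rw [Nat.cast_sub hd]; push_cast; ring
  have h4 := choose_mul_beta hd hN
  have hB : ProbabilityTheory.beta ((N - d : ℕ) + 1) d ≠ 0 := by
    intro h; rw [h] at h4; simp at h4
  rw [Phi, regIncBeta, h1, h2, div_eq_iff hB]
  simp only [add_sub_cancel_right, h3, Real.rpow_natCast]
  have h5 : ∀ t : ℝ, t ^ (N - d) * (d * (1 - t) ^ (d - 1)) =
    d * (t ^ (N - d) * (1 - t) ^ (d - 1)) := fun t => by ring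
  simp only [h5, intervalIntegral.integral_const_mul]
  linear_combination (-(∫ t in (0 : ℝ)..(1 - ε), t ^ (N - d) * (1 - t) ^ (d - 1))) * h4

/-! ### Schemes with a fixed number of support samples -/

/-- The distribution on `[0, 1]` of density `d (1 - t)^(d - 1)`: that of the smallest of `d`
independent uniform variables. -/
noncomputable def minUniform (d : ℕ) : Measure ℝ :=
  (volume.restrict (Set.Ioc (0 : ℝ) 1)).withDensity
    fun t => ENNReal.ofReal (d * (1 - t) ^ (d - 1))

theorem setIntegral_minUniform {d : ℕ} (f : ℝ → ℝ) {x : ℝ} (hx : x ∈ Set.Icc (0 : ℝ) 1) :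
    ∫ t in Set.Iic x, f t ∂(minUniform d) =
      ∫ t in (0 : ℝ)..x, f t * (d * (1 - t) ^ (d - 1)) := by
  have hset : Set.Iic x ∩ Set.Ioc (0 : ℝ) 1 = Set.Ioc 0 x := by
    ext t; simp only [Set.mem_inter_iff, Set.mem_Iic, Set.mem_Ioc]
    constructor
    · rintro ⟨h1, h2, h3⟩; exact ⟨h2, h1⟩
    · rintro ⟨h1, h2⟩; exact ⟨h2, h1, h2.trans hx.2⟩
  rw [minUniform, restrict_withDensity measurableSet_Iic, Measure.restrict_restrict
    measurableSet_Iic, hset, integral_withDensity_eq_integral_toReal_smul (by fun_prop)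
    (Eventually.of_forall fun _ => ENNReal.ofReal_lt_top), intervalIntegral.integral_of_le hx.1]
  refine setIntegral_congr_fun measurableSet_Ioc fun t ht => ?_
  have : 0 ≤ 1 - t := sub_nonneg.2 (ht.2.trans hx.2)
  simp only [smul_eq_mul]
  rw [ENNReal.toReal_ofReal (by positivity), mul_comm]

theorem ae_minUniform (d : ℕ) : ∀ᵐ t ∂(minUniform d), t ∈ Set.Ioc (0 : ℝ) 1 :=
  (withDensity_absolutelyContinuous _ _).ae_le (ae_restrict_mem measurableSet_Ioc)

instance isFiniteMeasure_minUniform (d : ℕ) : IsFiniteMeasure (minUniform d) := by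
  refine isFiniteMeasure_withDensity_ofReal ?_
  refine Integrable.hasFiniteIntegral ?_
  exact (Continuous.integrableOn_Icc (by fun_prop)).mono_set Set.Ioc_subset_Icc_self

/-- The moments of `minUniform d` are the inverses of binomial coefficients. -/
theorem integral_pow_minUniform {d : ℕ} (hd : 1 ≤ d) (k : ℕ) :
    ((k + d).choose d : ℝ) * ∫ t, t ^ k ∂(minUniform d) = 1 := by
  have h : ∫ t, t ^ k ∂(minUniform d) = ∫ t in Set.Iic (1 : ℝ), t ^ k ∂(minUniform d) := by
    rw [setIntegral_eq_integral_of_ae_compl_eq_zero]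
    filter_upwards [ae_minUniform d] with t ht h
    exact absurd ht.2 h
  have h1 := Phi_eq_integral hd (Nat.le_add_left d k) 0
  rw [Nat.add_sub_cancel, sub_zero] at h1
  rw [h, setIntegral_minUniform _ ⟨zero_le_one, le_rfl⟩, ← h1, Phi, regIncBeta, sub_zero,
    integral_beta]
  · refine div_self (ProbabilityTheory.beta_pos ?_ ?_).ne'
    · rw [sub_pos]; exact_mod_cast (by omega : d - 1 < k + d)
    · positivity
  · rw [sub_pos]; exact_mod_cast (by omega : d - 1 < k + d)
  · positivity

section FullSupport

variable {Z : Type*} [MeasurableSpace Z] (μ : Measure Z) [IsProbabilityMeasure μ]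

/-- Consider a scheme accepting, for `d` samples `c`, the further samples `z` with `(c, z) ∈ S`.
If among any `N ≥ d` independent samples there is almost surely exactly one `d`-subset accepting
all the others, then the acceptance probability of `d` samples has moments
`E[q ^ k] = 1 / (k + d choose d)`, and hence the law `minUniform d`. -/
theorem map_acceptance_eq_minUniform {d : ℕ} (hd : 1 ≤ d) {S : Set ((Fin d → Z) × Z)}
    (hS : MeasurableSet S)
    (huniq : ∀ N, d ≤ N → ∀ᵐ ω ∂(Measure.pi fun _ : Fin N => μ),
      ∃! J : {J : Finset (Fin N) // J.card = d}, ∀ i ∉ J.1, (subfamily ω J, ω i) ∈ S) :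
    (Measure.pi fun _ : Fin d => μ).map (fun c => (μ (Prod.mk c ⁻¹' S)).toReal) =
      minUniform d := by
  have hq : Measurable fun c : Fin d → Z => μ (Prod.mk c ⁻¹' S) :=
    measurable_measure_prodMk_left hS
  have hmap : IsProbabilityMeasure ((Measure.pi fun _ : Fin d => μ).map
      (fun c => (μ (Prod.mk c ⁻¹' S)).toReal)) :=
    Measure.isProbabilityMeasure_map hq.ennreal_toReal.aemeasurable
  refine measure_eq_of_moments_eq ?_ ?_ fun k => ?_
  · refine (ae_map_iff (p := fun x => x ∈ Set.Icc (0 : ℝ) 1) hq.ennreal_toReal.aemeasurable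
      measurableSet_Icc).2 ?_
    exact Eventually.of_forall fun c => ⟨ENNReal.toReal_nonneg, measureReal_le_one⟩
  · filter_upwards [ae_minUniform d] with t ht using Set.Ioc_subset_Icc_self ht
  -- Summing over `J` the probabilities that `J` accepts the other samples gives one.
  have hsum : ((k + d).choose d : ENNReal) *
      ∫⁻ c, μ (Prod.mk c ⁻¹' S) ^ k ∂(Measure.pi fun _ : Fin d => μ) = 1 := by
    have hG : ∀ J : {J : Finset (Fin (k + d)) // J.card = d}, MeasurableSet
        {ω : Fin (k + d) → Z | ∀ i ∉ J.1, (subfamily ω J, ω i) ∈ S} := fun J => by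
      simp only [Set.ofPred_forall]
      exact MeasurableSet.iInter fun i => MeasurableSet.iInter fun _ =>
        ((measurable_subfamily J).prodMk (measurable_pi_apply i)) hS
    have h1 : ∑ J : {J : Finset (Fin (k + d)) // J.card = d},
        Measure.pi (fun _ : Fin (k + d) => μ)
          {ω | ∀ i ∉ J.1, (subfamily ω J, ω i) ∈ S} = 1 := by
      simp only [← lintegral_indicator_one (hG _)]
      rw [← lintegral_finsetSum _ fun J _ => measurable_one.indicator (hG J)]
      rw [lintegral_congr_ae (g := fun _ => 1)]
      · simp
      filter_upwards [huniq (k + d) (Nat.le_add_left d k)] with ω hω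
      obtain ⟨J, hJ, hJu⟩ := hω
      rw [Finset.sum_eq_single J]
      · exact Set.indicator_of_mem (by exact hJ) _
      · intro J' _ hne
        exact Set.indicator_of_notMem
          (s := {ω : Fin (k + d) → Z | ∀ i ∉ J'.1, (subfamily ω J', ω i) ∈ S})
          (fun h => hne (hJu J' h)) _
      · simp
    have h2 : ∀ J : {J : Finset (Fin (k + d)) // J.card = d},
        Measure.pi (fun _ : Fin (k + d) => μ)
          {ω | ∀ i ∉ J.1, (subfamily ω J, ω i) ∈ S} =
        ∫⁻ c, μ (Prod.mk c ⁻¹' S) ^ k ∂(Measure.pi fun _ : Fin d => μ) := fun J => by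
      have := pi_subfamily_event μ J hS MeasurableSet.univ
      simpa using this
    simp only [h2] at h1
    rw [Finset.sum_const, Finset.card_univ, Fintype.card_finset_len, Fintype.card_fin,
      nsmul_eq_mul] at h1
    exact h1
  have hreal := congrArg ENNReal.toReal hsum
  rw [ENNReal.toReal_mul, ENNReal.toReal_natCast, ENNReal.toReal_one] at hreal
  rw [integral_map hq.ennreal_toReal.aemeasurable (by fun_prop)]
  have h3 : ∫ c, (μ (Prod.mk c ⁻¹' S)).toReal ^ k ∂(Measure.pi fun _ : Fin d => μ) =
      (∫⁻ c, μ (Prod.mk c ⁻¹' S) ^ k ∂(Measure.pi fun _ : Fin d => μ)).toReal := by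
    simp only [← ENNReal.toReal_pow]
    exact integral_toReal (hq.pow_const k).aemeasurable
      (Eventually.of_forall fun c => ENNReal.pow_lt_top (measure_lt_top _ _))
  have hc : ((k + d).choose d : ℝ) ≠ 0 := by
    exact_mod_cast (Nat.choose_pos (Nat.le_add_left d k)).ne'
  rw [h3]
  exact mul_left_cancel₀ hc (hreal.trans (integral_pow_minUniform hd k).symm)

/-- The probability that some `d`-subset accepts all other samples although its acceptance
probability is below `1 - ε`. -/
theorem pi_exists_low_acceptance_le {d : ℕ} (hd : 1 ≤ d) {S : Set ((Fin d → Z) × Z)}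
    (hS : MeasurableSet S)
    (huniq : ∀ N, d ≤ N → ∀ᵐ ω ∂(Measure.pi fun _ : Fin N => μ),
      ∃! J : {J : Finset (Fin N) // J.card = d}, ∀ i ∉ J.1, (subfamily ω J, ω i) ∈ S)
    {N : ℕ} (hN : d ≤ N) {ε : ℝ} (hε : ε ∈ Set.Ioo (0 : ℝ) 1) :
    Measure.pi (fun _ : Fin N => μ)
      {ω | ∃ J : {J : Finset (Fin N) // J.card = d},
        (μ (Prod.mk (subfamily ω J) ⁻¹' S)).toReal ≤ 1 - ε ∧
          ∀ i ∉ J.1, (subfamily ω J, ω i) ∈ S} ≤ ENNReal.ofReal (Phi ε (d - 1) N) := by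
  have hq : Measurable fun c : Fin d → Z => (μ (Prod.mk c ⁻¹' S)).toReal :=
    (measurable_measure_prodMk_left hS).ennreal_toReal
  have hQ : MeasurableSet {c : Fin d → Z | (μ (Prod.mk c ⁻¹' S)).toReal ≤ 1 - ε} :=
    measurableSet_le hq measurable_const
  have hlint : ∫⁻ c in {c : Fin d → Z | (μ (Prod.mk c ⁻¹' S)).toReal ≤ 1 - ε},
      μ (Prod.mk c ⁻¹' S) ^ (N - d) ∂(Measure.pi fun _ : Fin d => μ) =
      ENNReal.ofReal (∫ t in (0 : ℝ)..(1 - ε), t ^ (N - d) * (d * (1 - t) ^ (d - 1))) := by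
    rw [← setIntegral_minUniform (fun t => t ^ (N - d))
      ⟨by linarith [hε.2], by linarith [hε.1]⟩, ← map_acceptance_eq_minUniform μ hd hS huniq,
      setIntegral_map measurableSet_Iic (by fun_prop) hq.aemeasurable]
    rw [ofReal_integral_eq_lintegral_ofReal]
    · refine lintegral_congr fun c => ?_
      rw [ENNReal.ofReal_pow ENNReal.toReal_nonneg, ENNReal.ofReal_toReal (measure_ne_top _ _)]
    · refine Integrable.of_bound (hq.pow_const _).aestronglyMeasurable 1
        (Eventually.of_forall fun c => ?_)
      rw [Real.norm_eq_abs, abs_of_nonneg (by positivity)]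
      exact pow_le_one₀ ENNReal.toReal_nonneg measureReal_le_one
    · exact Eventually.of_forall fun c => by positivity
  calc Measure.pi (fun _ : Fin N => μ)
        {ω | ∃ J : {J : Finset (Fin N) // J.card = d},
          (μ (Prod.mk (subfamily ω J) ⁻¹' S)).toReal ≤ 1 - ε ∧
            ∀ i ∉ J.1, (subfamily ω J, ω i) ∈ S}
      ≤ ∑ J : {J : Finset (Fin N) // J.card = d}, Measure.pi (fun _ : Fin N => μ)
        {ω | (μ (Prod.mk (subfamily ω J) ⁻¹' S)).toReal ≤ 1 - ε ∧
            ∀ i ∉ J.1, (subfamily ω J, ω i) ∈ S} := by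
        rw [Set.ofPred_exists]
        exact measure_iUnion_fintype_le _ _
    _ = ∑ _J : {J : Finset (Fin N) // J.card = d},
        ENNReal.ofReal (∫ t in (0 : ℝ)..(1 - ε), t ^ (N - d) * (d * (1 - t) ^ (d - 1))) :=
        Finset.sum_congr rfl fun J _ => (pi_subfamily_event μ J hS hQ).trans hlint
    _ = ENNReal.ofReal (Phi ε (d - 1) N) := by
        rw [Phi_eq_integral hd hN, ENNReal.ofReal_mul (by positivity), Finset.sum_const,
          Finset.card_univ, Fintype.card_finset_len, Fintype.card_fin, nsmul_eq_mul,
          ENNReal.ofReal_natCast]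

end FullSupport

/-! ### Violation probability of sampled problems -/

/-- A `k`-subset of `Fin N` containing `T` whose other elements carry the smallest labels among
the elements outside `T`. -/
theorem exists_superset_smallest_labels {N : ℕ} {u : Fin N → ℝ} (hu : Function.Injective u)
    (T : Finset (Fin N)) {k : ℕ} (hT : T.card ≤ k) (hk : k ≤ N) :
    ∃ J : Finset (Fin N), T ⊆ J ∧ J.card = k ∧ ∀ i ∈ J, i ∉ T → ∀ j ∉ J, u i < u j := by
  induction k, hT using Nat.le_induction with
  | base => exact ⟨T, subset_rfl, rfl, fun i hi hi' => absurd hi hi'⟩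
  | succ k hTk ih =>
    obtain ⟨J, hTJ, hJ, hlab⟩ := ih (by omega)
    have hne : Jᶜ.Nonempty := by
      rw [← Finset.card_pos, Finset.card_compl, Fintype.card_fin]; omega
    obtain ⟨j, hj, hmin⟩ := Jᶜ.exists_min_image u hne
    rw [Finset.mem_compl] at hj
    refine ⟨insert j J, hTJ.trans (Finset.subset_insert _ _),
      by rw [Finset.card_insert_of_notMem hj, hJ], fun i hi hiT l hl => ?_⟩
    rw [Finset.mem_insert, not_or] at hl
    rcases Finset.mem_insert.1 hi with rfl | hi
    · exact lt_of_le_of_ne (hmin l (Finset.mem_compl.2 hl.2)) fun h => hl.1 (hu h).symm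
    · exact hlab i hi hiT l hl.2

/-- A rule `sol` assigning a solution to each set of samples, in the manner of an optimization
problem with sampled constraints: `sat` and `tight` are the pairs (solution, sample) for which the
constraint of the sample holds, resp. holds with equality, and every optimum over a finite set of
samples is determined by at most `d` of them. -/
structure IsSampledProblem {Δ X : Type*} [MeasurableSpace Δ] [MeasurableSpace X] (μ : Measure Δ)
    (d : ℕ) (sol : Set Δ → X) (sat tight : Set (X × Δ)) : Prop where
  measurableSet_sat : MeasurableSet sat
  measurableSet_tight : MeasurableSet tight
  measurable_sol : ∀ k, Measurable fun ω : Fin k → Δ => sol (Set.range ω)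
  sat_of_mem : ∀ ω : Set Δ, ω.Finite → ∀ δ ∈ ω, (sol ω, δ) ∈ sat
  sol_eq_of_sat : ∀ ω ω' : Set Δ, ω'.Finite → ω ⊆ ω' → (∀ δ ∈ ω', (sol ω, δ) ∈ sat) →
    sol ω' = sol ω
  sol_sdiff_of_not_tight : ∀ ω : Set Δ, ω.Finite → ∀ δ ∈ ω, (sol ω, δ) ∉ tight →
    sol (ω \ {δ}) = sol ω
  tight_null : ∀ ω : Set Δ, ω.Finite → μ (Prod.mk (sol ω) ⁻¹' tight) = 0
  exists_small : ∀ ω : Set Δ, ω.Finite → ∃ ω₀ ⊆ ω, ω₀.ncard ≤ d ∧ sol ω₀ = sol ω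

namespace IsSampledProblem

variable {Δ X : Type*} [MeasurableSpace Δ] [MeasurableSpace X] {μ : Measure Δ}
  {d : ℕ} {sol : Set Δ → X} {sat tight : Set (X × Δ)}

/-- The tight samples alone determine the solution. -/
theorem sol_tight (h : IsSampledProblem μ d sol sat tight) {N : ℕ} (ω : Fin N → Δ) {s : X}
    (K : Finset (Fin N)) (hK : sol (ω '' K) = s) :
    ∃ T ⊆ K, (∀ i ∈ K, i ∈ T ↔ (s, ω i) ∈ tight) ∧ sol (ω '' T) = s := by
  induction K using Finset.strongInduction with
  | H K ih =>
    by_cases hall : ∀ i ∈ K, (s, ω i) ∈ tight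
    · exact ⟨K, subset_rfl, fun i hi => ⟨fun _ => hall i hi, fun _ => hi⟩, hK⟩
    · push Not at hall
      obtain ⟨i, hi, hit⟩ := hall
      have herase : sol (ω '' (K.erase i : Finset (Fin N))) = s := by
        by_cases hdup : ∃ j ∈ K, j ≠ i ∧ ω j = ω i
        · obtain ⟨j, hj, hji, hjω⟩ := hdup
          rw [← hK]
          congr 1
          ext δ
          constructor
          · rintro ⟨l, hl, rfl⟩
            exact ⟨l, Finset.mem_of_mem_erase hl, rfl⟩
          · rintro ⟨l, hl, rfl⟩
            by_cases hli : l = i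
            · exact ⟨j, Finset.mem_coe.2 (Finset.mem_erase.2 ⟨hji, hj⟩), by rw [hjω, hli]⟩
            · exact ⟨l, Finset.mem_coe.2 (Finset.mem_erase.2 ⟨hli, hl⟩), rfl⟩
        · push Not at hdup
          have hset : ω '' (K.erase i : Finset (Fin N)) = (ω '' K) \ {ω i} := by
            ext δ
            constructor
            · rintro ⟨l, hl, rfl⟩
              have hl' := Finset.mem_erase.1 (Finset.mem_coe.1 hl)
              exact ⟨⟨l, hl'.2, rfl⟩, hdup l hl'.2 hl'.1⟩
            · rintro ⟨⟨l, hl, rfl⟩, hne⟩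
              refine ⟨l, Finset.mem_coe.2 (Finset.mem_erase.2 ⟨?_, hl⟩), rfl⟩
              rintro rfl
              exact hne rfl
          rw [hset, h.sol_sdiff_of_not_tight (ω '' K) (Set.toFinite _) (ω i) ⟨i, hi, rfl⟩
            (by rwa [hK]), hK]
      obtain ⟨T, hT, hTt, hTs⟩ := ih _ (Finset.erase_ssubset hi) herase
      refine ⟨T, hT.trans (Finset.erase_subset _ _), fun l hl => ?_, hTs⟩
      by_cases hli : l = i
      · subst hli
        exact ⟨fun hlT => absurd (hT hlT) (Finset.notMem_erase _ _), fun hlt => absurd hlt hit⟩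
      · exact hTt l (Finset.mem_erase.2 ⟨hli, hl⟩)

/-- The labelled scheme attached to a sampled problem: `d` labelled samples accept a further one
if their solution satisfies its constraint and its label exceeds the labels of the non-tight
samples among the `d`. -/
def accept (d : ℕ) (sol : Set Δ → X) (sat tight : Set (X × Δ)) :
    Set ((Fin d → Δ × ℝ) × (Δ × ℝ)) :=
  {p | (sol (Set.range fun a => (p.1 a).1), p.2.1) ∈ sat ∧
    ∀ a, (sol (Set.range fun a => (p.1 a).1), (p.1 a).1) ∉ tight → (p.1 a).2 < p.2.2}

theorem measurable_sol_fst (h : IsSampledProblem μ d sol sat tight) (k : ℕ) :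
    Measurable fun p : (Fin k → Δ × ℝ) × (Δ × ℝ) => sol (Set.range fun a => (p.1 a).1) :=
  (h.measurable_sol k).comp (measurable_pi_lambda _ fun a =>
    measurable_fst.comp ((measurable_pi_apply a).comp measurable_fst))

theorem measurableSet_accept (h : IsSampledProblem μ d sol sat tight) :
    MeasurableSet (accept d sol sat tight) := by
  have h1 : accept d sol sat tight =
      ((fun p : (Fin d → Δ × ℝ) × (Δ × ℝ) =>
        (sol (Set.range fun a => (p.1 a).1), p.2.1)) ⁻¹' sat) ∩
      ⋂ a, (((fun p : (Fin d → Δ × ℝ) × (Δ × ℝ) =>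
        (sol (Set.range fun a => (p.1 a).1), (p.1 a).1)) ⁻¹' tight) ∪
        {p | (p.1 a).2 < p.2.2}) := by
    ext p
    simp [accept, or_iff_not_imp_left]
  rw [h1]
  refine (((h.measurable_sol_fst d).prodMk measurable_snd.fst) h.measurableSet_sat).inter
    (MeasurableSet.iInter fun a => MeasurableSet.union ?_ ?_)
  · exact ((h.measurable_sol_fst d).prodMk
      ((measurable_pi_apply a).comp measurable_fst).fst) h.measurableSet_tight
  · exact measurableSet_lt ((measurable_pi_apply a).comp measurable_fst).snd measurable_snd.snd

theorem range_subfamily_fst {Δ : Type*} {N k : ℕ} (ω : Fin N → Δ × ℝ)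
    (J : {J : Finset (Fin N) // J.card = k}) :
    (Set.range fun a => (subfamily ω J a).1) = (fun i => (ω i).1) '' J.1 := by
  rw [← Finset.range_orderEmbOfFin J.1 J.2, ← Set.range_comp]
  rfl

variable [IsProbabilityMeasure μ]

instance isProbabilityMeasure_label :
    IsProbabilityMeasure (volume.restrict (Set.Ioc (0 : ℝ) 1)) :=
  ⟨by simp⟩

/-- Almost surely no sample is tight for the solution determined by other samples. -/
theorem ae_not_tight (h : IsSampledProblem μ d sol sat tight) (N : ℕ) :
    ∀ᵐ ω ∂(Measure.pi fun _ : Fin N => μ.prod (volume.restrict (Set.Ioc (0 : ℝ) 1))),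
      ∀ K : Finset (Fin N), ∀ i ∉ K, (sol ((fun i => (ω i).1) '' K), (ω i).1) ∉ tight := by
  rw [ae_all_iff]
  intro K
  let S : Set ((Fin K.card → Δ × ℝ) × (Δ × ℝ)) :=
    {p | (sol (Set.range fun a => (p.1 a).1), p.2.1) ∈ tight}
  have hS : MeasurableSet S :=
    ((h.measurable_sol_fst K.card).prodMk measurable_snd.fst) h.measurableSet_tight
  have h0 : ∀ c, (μ.prod (volume.restrict (Set.Ioc (0 : ℝ) 1))) (Prod.mk c ⁻¹' S) = 0 := by
    intro c
    have : Prod.mk c ⁻¹' S =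
        (Prod.mk (sol (Set.range fun a => (c a).1)) ⁻¹' tight) ×ˢ Set.univ := by
      ext z; simp [S]
    rw [this, Measure.prod_prod, h.tight_null _ (Set.finite_range _), zero_mul]
  filter_upwards [ae_pi_subfamily_notMem _ ⟨K, rfl⟩ hS h0] with ω hω i hi
  have := hω i hi
  rwa [Set.mem_ofPred_eq, range_subfamily_fst] at this

theorem ae_injective_label (μ : Measure Δ) [IsProbabilityMeasure μ] (N : ℕ) :
    ∀ᵐ ω ∂(Measure.pi fun _ : Fin N => μ.prod (volume.restrict (Set.Ioc (0 : ℝ) 1))),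
      Function.Injective fun i => (ω i).2 := by
  let S : Set ((Fin 1 → Δ × ℝ) × (Δ × ℝ)) := {p | p.2.2 = (p.1 0).2}
  have hS : MeasurableSet S :=
    measurableSet_eq_fun measurable_snd.snd ((measurable_pi_apply 0).comp measurable_fst).snd
  have h0 : ∀ c, (μ.prod (volume.restrict (Set.Ioc (0 : ℝ) 1))) (Prod.mk c ⁻¹' S) = 0 := by
    intro c
    have : Prod.mk c ⁻¹' S = Set.univ ×ˢ {(c 0).2} := by
      ext z; simp [S]
    rw [this, Measure.prod_prod, measure_singleton, mul_zero]
  have := fun i : Fin N => ae_pi_subfamily_notMem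
    (μ.prod (volume.restrict (Set.Ioc (0 : ℝ) 1))) ⟨{i}, Finset.card_singleton i⟩ hS h0
  filter_upwards [ae_all_iff.2 this] with ω hω i j hij
  by_contra hne
  refine hω i j (by simpa using fun h => hne h.symm) ?_
  simp only [S, Set.mem_ofPred_eq, subfamily]
  have hij' : (ω i).2 = (ω j).2 := hij
  rw [← hij', Finset.mem_singleton.1 (Finset.orderEmbOfFin_mem {i} (Finset.card_singleton i) 0)]

/-- Almost surely exactly one `d`-subset accepts all the other samples: the tight samples of the
whole family, completed by the samples of smallest labels. -/
theorem ae_existsUnique_accept (h : IsSampledProblem μ d sol sat tight) {N : ℕ} (hN : d ≤ N) :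
    ∀ᵐ ω ∂(Measure.pi fun _ : Fin N => μ.prod (volume.restrict (Set.Ioc (0 : ℝ) 1))),
      ∃! J : {J : Finset (Fin N) // J.card = d},
        ∀ i ∉ J.1, (subfamily ω J, ω i) ∈ accept d sol sat tight := by
  filter_upwards [h.ae_not_tight N, ae_injective_label μ N] with ω hgood hinj
  set f : Fin N → Δ := fun i => (ω i).1
  have haccept : ∀ (J : {J : Finset (Fin N) // J.card = d}) (i : Fin N),
      (subfamily ω J, ω i) ∈ accept d sol sat tight ↔ (sol (f '' J.1), f i) ∈ sat ∧
        ∀ j ∈ J.1, (sol (f '' J.1), f j) ∉ tight → (ω j).2 < (ω i).2 := by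
    intro J i
    simp only [accept, Set.mem_ofPred_eq]
    rw [range_subfamily_fst]
    refine and_congr_right fun _ => ⟨fun H j hj => ?_, fun H a => ?_⟩
    · have : j ∈ Set.range (J.1.orderEmbOfFin J.2) := by
        rw [Finset.range_orderEmbOfFin]; exact hj
      obtain ⟨a, rfl⟩ := this
      exact H a
    · exact H _ (Finset.orderEmbOfFin_mem _ _ a)
  have huniv : sol (f '' (Finset.univ : Finset (Fin N))) = sol (Set.range f) := by simp
  obtain ⟨T, -, hT, hTs⟩ := h.sol_tight f Finset.univ huniv
  set s := sol (Set.range f)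
  -- A set of indices that determines the solution contains all tight indices.
  have hsub : ∀ K : Finset (Fin N), sol (f '' K) = s → T ⊆ K := by
    intro K hK i hi
    by_contra hiK
    exact hgood K i hiK (by rw [hK]; exact (hT i (Finset.mem_univ i)).1 hi)
  have hTd : T.card ≤ d := by
    classical
    obtain ⟨ω₀, hω₀, hcard, hsol⟩ := h.exists_small (Set.range f) (Set.finite_range f)
    have hfin : ω₀.Finite := (Set.finite_range f).subset hω₀
    have := hfin.fintype
    choose g hg using fun δ : ω₀ => hω₀ δ.2
    refine (Finset.card_le_card (hsub (Finset.univ.image g) ?_)).trans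
      (Finset.card_image_le.trans ?_)
    · refine Eq.trans (congrArg sol ?_) hsol
      ext δ
      constructor
      · rintro ⟨i, hi, rfl⟩
        obtain ⟨δ, -, rfl⟩ := Finset.mem_image.1 (Finset.mem_coe.1 hi)
        rw [hg δ]
        exact δ.2
      · intro hδ
        exact ⟨g ⟨δ, hδ⟩, by simp, hg ⟨δ, hδ⟩⟩
    · rwa [Finset.card_univ, Set.fintypeCard_eq_ncard]
  have hdet : ∀ K : Finset (Fin N), T ⊆ K → sol (f '' K) = s := by
    intro K hK
    rw [← hTs]
    refine h.sol_eq_of_sat _ _ (Set.toFinite _) (Set.image_mono hK) fun δ hδ => ?_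
    rw [hTs]
    obtain ⟨i, -, rfl⟩ := hδ
    exact h.sat_of_mem _ (Set.finite_range f) _ ⟨i, rfl⟩
  obtain ⟨J, hTJ, hJ, hlab⟩ := exists_superset_smallest_labels hinj T hTd hN
  refine ⟨⟨J, hJ⟩, fun i hi => (haccept _ _).2 ?_, ?_⟩
  · rw [hdet J hTJ]
    exact ⟨h.sat_of_mem _ (Set.finite_range f) _ ⟨i, rfl⟩, fun j hj hjt =>
      hlab j hj (fun hjT => hjt ((hT j (Finset.mem_univ j)).1 hjT)) i hi⟩
  · rintro ⟨K, hK⟩ hacc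
    have hKs : sol (f '' K) = s := by
      have := h.sol_eq_of_sat (f '' K) (Set.range f) (Set.finite_range f)
        (Set.image_subset_range f _) ?_
      · exact this.symm
      · rintro _ ⟨i, rfl⟩
        by_cases hi : i ∈ K
        · exact h.sat_of_mem _ (Set.toFinite _) _ ⟨i, hi, rfl⟩
        · exact ((haccept _ _).1 (hacc i hi)).1
    have hTK := hsub K hKs
    have hKJ : K ⊆ J := by
      by_contra hnot
      obtain ⟨i, hiK, hiJ⟩ := Finset.not_subset.1 hnot
      obtain ⟨j, hjJ, hjK⟩ : ∃ j ∈ J, j ∉ K := by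
        by_contra hall
        push Not at hall
        exact hiJ ((Finset.eq_of_subset_of_card_le hall (by rw [hK, hJ])).symm ▸ hiK)
      have h1 := hlab j hjJ (fun hjT => hjK (hTK hjT)) i hiJ
      have h2 := ((haccept ⟨K, hK⟩ j).1 (hacc j hjK)).2 i hiK (by
        rw [hKs]
        exact fun hit => hiJ (hTJ ((hT i (Finset.mem_univ i)).2 hit)))
      exact lt_asymm h1 h2
    exact Subtype.ext (Finset.eq_of_subset_of_card_le hKJ (by rw [hK, hJ]))

/-- The sampled solution satisfies the constraint of a new sample with probability at least
`1 - ε`, except with probability `Φ(ε, d - 1, N)`. -/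
theorem pi_low_sat_le (h : IsSampledProblem μ d sol sat tight) (hd : 1 ≤ d) {N : ℕ}
    (hN : d ≤ N) {ε : ℝ} (hε : ε ∈ Set.Ioo (0 : ℝ) 1) :
    Measure.pi (fun _ : Fin N => μ)
      {ω | (μ (Prod.mk (sol (Set.range ω)) ⁻¹' sat)).toReal < 1 - ε} ≤
        ENNReal.ofReal (Phi ε (d - 1) N) := by
  have hmp : MeasurePreserving (fun (ω : Fin N → Δ × ℝ) i => (ω i).1)
      (Measure.pi fun _ : Fin N => μ.prod (volume.restrict (Set.Ioc (0 : ℝ) 1)))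
      (Measure.pi fun _ : Fin N => μ) :=
    measurePreserving_pi _ _ fun _ => measurePreserving_fst
  have hm : MeasurableSet
      {ω : Fin N → Δ | (μ (Prod.mk (sol (Set.range ω)) ⁻¹' sat)).toReal < 1 - ε} :=
    measurableSet_lt ((measurable_measure_prodMk_left h.measurableSet_sat).comp
      (h.measurable_sol N)).ennreal_toReal measurable_const
  rw [← hmp.measure_preimage hm.nullMeasurableSet]
  refine le_trans (measure_mono_ae ?_) (pi_exists_low_acceptance_le _ hd h.measurableSet_accept
    (fun M hM => h.ae_existsUnique_accept hM) hN hε)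
  filter_upwards [h.ae_existsUnique_accept hN] with ω ⟨J, hJ, _⟩ hlow
  refine ⟨J, ?_, hJ⟩
  have hsol : sol (Set.range fun a => (subfamily ω J a).1) = sol (Set.range fun i => (ω i).1) := by
    have := h.sol_eq_of_sat (Set.range fun a => (subfamily ω J a).1) (Set.range fun i => (ω i).1)
      (Set.finite_range _) (by rw [range_subfamily_fst]; exact Set.image_subset_range _ _) ?_
    · exact this.symm
    · rintro _ ⟨i, rfl⟩
      by_cases hi : i ∈ J.1
      · exact h.sat_of_mem _ (Set.finite_range _) _
          (by rw [range_subfamily_fst]; exact ⟨i, hi, rfl⟩)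
      · exact (hJ i hi).1
  refine le_trans ?_ hlow.le
  refine ENNReal.toReal_mono (measure_ne_top _ _) ?_
  calc (μ.prod (volume.restrict (Set.Ioc (0 : ℝ) 1)))
        (Prod.mk (subfamily ω J) ⁻¹' accept d sol sat tight)
      ≤ (μ.prod (volume.restrict (Set.Ioc (0 : ℝ) 1)))
        ((Prod.mk (sol (Set.range fun i => (ω i).1)) ⁻¹' sat) ×ˢ Set.univ) := by
        refine measure_mono fun z hz => ⟨?_, Set.mem_univ _⟩
        rw [← hsol]
        exact hz.1
    _ = _ := by rw [Measure.prod_prod, measure_univ, mul_one]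

end IsSampledProblem

/-! ### The incomplete beta function and powers of the cosine -/

theorem intervalIntegrable_cos_pow (m : ℕ) (a b : ℝ) :
    IntervalIntegrable (fun x => Real.cos x ^ m) volume a b :=
  (by fun_prop : Continuous fun x => Real.cos x ^ m).intervalIntegrable a b

theorem integral_cos_pow_pos (m : ℕ) {a b : ℝ} (ha : -(Real.pi / 2) ≤ a) (hab : a < b)
    (hb : b ≤ Real.pi / 2) : 0 < ∫ x in a..b, Real.cos x ^ m :=
  intervalIntegral.intervalIntegral_pos_of_pos_on (intervalIntegrable_cos_pow m a b)
    (fun _ hx => pow_pos (Real.cos_pos_of_mem_Ioo ⟨ha.trans_lt hx.1, hx.2.trans_le hb⟩) m) hab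

/-- The substitution `t = cos² x`. -/
theorem integral_beta_cos_sq (m : ℕ) {θ : ℝ} (hθ : θ ∈ Set.Icc 0 (Real.pi / 2)) :
    ∫ t in (0 : ℝ)..Real.cos θ ^ 2, t ^ (((m : ℝ) + 1) / 2 - 1) * (1 - t) ^ ((1 : ℝ) / 2 - 1) =
      2 * ∫ x in θ..(Real.pi / 2), Real.cos x ^ m := by
  set g : ℝ → ℝ := fun t => t ^ (((m : ℝ) + 1) / 2 - 1) * (1 - t) ^ ((1 : ℝ) / 2 - 1)
  have hioo : ∀ x ∈ Set.Ioo θ (Real.pi / 2), 0 < Real.cos x ∧ 0 < Real.sin x := fun x hx =>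
    ⟨Real.cos_pos_of_mem_Ioo ⟨by linarith [hθ.1, hx.1, Real.pi_pos], hx.2⟩,
      Real.sin_pos_of_pos_of_lt_pi (hθ.1.trans_lt hx.1) (by linarith [hx.2, Real.pi_pos])⟩
  have hgf : ∀ x ∈ Set.Ioo θ (Real.pi / 2),
      g (Real.cos x ^ 2) * (-(2 * Real.cos x * Real.sin x)) = -(2 * Real.cos x ^ m) := by
    intro x hx
    obtain ⟨hc, hs⟩ := hioo x hx
    have h1 : (Real.cos x ^ 2) ^ (((m : ℝ) + 1) / 2 - 1) * Real.cos x = Real.cos x ^ m := by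
      rw [← Real.rpow_natCast _ 2, ← Real.rpow_mul hc.le]
      nth_rewrite 2 [← Real.rpow_one (Real.cos x)]
      rw [← Real.rpow_add hc, ← Real.rpow_natCast _ m]
      congr 1
      push_cast
      ring
    have h2 : (1 - Real.cos x ^ 2) ^ ((1 : ℝ) / 2 - 1) * Real.sin x = 1 := by
      rw [← Real.sin_sq, ← Real.rpow_natCast _ 2, ← Real.rpow_mul hs.le]
      nth_rewrite 2 [← Real.rpow_one (Real.sin x)]
      rw [← Real.rpow_add hs]
      norm_num
    calc g (Real.cos x ^ 2) * (-(2 * Real.cos x * Real.sin x))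
        = -(2 * ((Real.cos x ^ 2) ^ (((m : ℝ) + 1) / 2 - 1) * Real.cos x) *
          ((1 - Real.cos x ^ 2) ^ ((1 : ℝ) / 2 - 1) * Real.sin x)) := by simp only [g]; ring
      _ = _ := by rw [h1, h2]; ring
  have hint : IntegrableOn g (Set.Icc 0 1) := by
    have := intervalIntegrable_beta (a := ((m : ℝ) + 1) / 2) (b := 1 / 2) (by positivity)
      (by norm_num)
    rwa [intervalIntegrable_iff_integrableOn_Icc_of_le zero_le_one] at this
  have hmain := intervalIntegral.integral_comp_mul_deriv''' (a := θ) (b := Real.pi / 2)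
    (f := fun x => Real.cos x ^ 2) (f' := fun x => -(2 * Real.cos x * Real.sin x)) (g := g)
    (by fun_prop) ?_ ?_ ?_ ?_
  · rw [Real.cos_pi_div_two, zero_pow two_ne_zero] at hmain
    rw [intervalIntegral.integral_symm, ← hmain, ← intervalIntegral.integral_const_mul,
      ← intervalIntegral.integral_neg, intervalIntegral.integral_of_le hθ.2,
      intervalIntegral.integral_of_le hθ.2, integral_Ioc_eq_integral_Ioo,
      integral_Ioc_eq_integral_Ioo]
    refine setIntegral_congr_fun measurableSet_Ioo fun x hx => ?_
    exact (neg_eq_iff_eq_neg.2 (hgf x hx))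
  · intro x _
    refine HasDerivAt.hasDerivWithinAt (HasDerivAt.congr_deriv ((Real.hasDerivAt_cos x).pow 2) ?_)
    push_cast
    ring
  · rw [min_eq_left hθ.2, max_eq_right hθ.2]
    rintro _ ⟨x, hx, rfl⟩
    obtain ⟨hc, hs⟩ := hioo x hx
    refine ContinuousAt.continuousWithinAt (ContinuousAt.mul ?_ ?_)
    · exact Real.continuousAt_rpow_const _ _ (Or.inl (by positivity))
    · refine ContinuousAt.rpow_const (by fun_prop) (Or.inl ?_)
      simp only
      rw [← Real.sin_sq]
      positivity
  · refine hint.mono_set ?_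
    rintro _ ⟨x, -, rfl⟩
    exact ⟨sq_nonneg _, Real.cos_sq_le_one x⟩
  · rw [Set.uIcc_of_le hθ.2, integrableOn_Icc_iff_integrableOn_Ioo]
    refine IntegrableOn.congr_fun (f := fun x => -(2 * Real.cos x ^ m)) ?_
      (fun x hx => (hgf x hx).symm) measurableSet_Ioo
    exact (Continuous.integrableOn_Icc (by fun_prop)).mono_set Set.Ioo_subset_Icc_self

/-- `I(cos² θ; (m + 1)/2, 1/2)` is the proportion of the integral of `cos ^ m` over `[0, π/2]`
carried by `[θ, π/2]`. -/
theorem regIncBeta_cos_sq (m : ℕ) {θ : ℝ} (hθ : θ ∈ Set.Icc 0 (Real.pi / 2)) :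
    regIncBeta (Real.cos θ ^ 2) (((m : ℝ) + 1) / 2) (1 / 2) =
      (∫ x in θ..(Real.pi / 2), Real.cos x ^ m) /
        ∫ x in (0 : ℝ)..(Real.pi / 2), Real.cos x ^ m := by
  have h0 := integral_beta_cos_sq m (θ := 0) ⟨le_rfl, by positivity⟩
  rw [Real.cos_zero, one_pow, integral_beta (by positivity) (by norm_num)] at h0
  rw [regIncBeta, integral_beta_cos_sq m hθ, h0, mul_div_mul_left _ _ two_ne_zero]

/-- The inverse incomplete beta function at `y ∈ [0, 1)`, in terms of an angle. -/
theorem exists_regIncBetaInv_eq_cos_sq (m : ℕ) {y : ℝ} (hy : y ∈ Set.Ico (0 : ℝ) 1) :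
    ∃ θ ∈ Set.Ioc 0 (Real.pi / 2),
      regIncBetaInv y (((m : ℝ) + 1) / 2) (1 / 2) = Real.cos θ ^ 2 ∧
      (∫ x in θ..(Real.pi / 2), Real.cos x ^ m) /
        ∫ x in (0 : ℝ)..(Real.pi / 2), Real.cos x ^ m = y := by
  have hpos := integral_cos_pow_pos m (a := 0) (b := Real.pi / 2) (by linarith [Real.pi_pos])
    (by positivity) le_rfl
  have hcont : ContinuousOn (fun θ => (∫ x in θ..(Real.pi / 2), Real.cos x ^ m) /
      ∫ x in (0 : ℝ)..(Real.pi / 2), Real.cos x ^ m) (Set.Icc 0 (Real.pi / 2)) := by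
    refine ContinuousOn.div_const ?_ _
    have h : ∀ θ : ℝ, ∫ x in θ..(Real.pi / 2), Real.cos x ^ m =
        (∫ x in (0 : ℝ)..(Real.pi / 2), Real.cos x ^ m) - ∫ x in (0 : ℝ)..θ, Real.cos x ^ m :=
      fun θ => (intervalIntegral.integral_interval_sub_left (intervalIntegrable_cos_pow m _ _)
        (intervalIntegrable_cos_pow m _ _)).symm
    refine ContinuousOn.congr ?_ fun θ _ => h θ
    exact (continuous_const.sub (intervalIntegral.continuous_primitive
      (fun a b => intervalIntegrable_cos_pow m a b) 0)).continuousOn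
  obtain ⟨θ₀, hθ₀, hθ₀y⟩ := intermediate_value_Icc' (by positivity : (0 : ℝ) ≤ Real.pi / 2) hcont
    (⟨by simpa using hy.1, by rw [div_self hpos.ne']; exact hy.2.le⟩ :
      y ∈ Set.Icc ((∫ x in (Real.pi / 2)..(Real.pi / 2), Real.cos x ^ m) /
        ∫ x in (0 : ℝ)..(Real.pi / 2), Real.cos x ^ m) _)
  have hex : ∃ x ∈ Set.Icc (0 : ℝ) 1,
      (fun x => regIncBeta x (((m : ℝ) + 1) / 2) (1 / 2)) x = y :=
    ⟨Real.cos θ₀ ^ 2, ⟨sq_nonneg _, Real.cos_sq_le_one _⟩,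
      (regIncBeta_cos_sq m hθ₀).trans hθ₀y⟩
  have hmem := Function.invFunOn_mem hex
  have heq := Function.invFunOn_eq hex
  set x₀ := Function.invFunOn (fun x => regIncBeta x (((m : ℝ) + 1) / 2) (1 / 2))
    (Set.Icc 0 1) y with hx₀
  have hsq : √x₀ ^ 2 = x₀ := Real.sq_sqrt hmem.1
  have hcos : Real.cos (Real.arccos √x₀) = √x₀ :=
    Real.cos_arccos (by linarith [Real.sqrt_nonneg x₀]) (Real.sqrt_le_one.2 hmem.2)
  have hθ : Real.arccos √x₀ ∈ Set.Icc 0 (Real.pi / 2) :=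
    ⟨Real.arccos_nonneg _, Real.arccos_le_pi_div_two.2 (Real.sqrt_nonneg _)⟩
  have hval := regIncBeta_cos_sq m hθ
  rw [hcos, hsq] at hval
  have hvy := hval.symm.trans heq
  refine ⟨Real.arccos √x₀, ⟨lt_of_le_of_ne hθ.1 fun h => ?_, hθ.2⟩, by rw [hcos, hsq]; rfl, hvy⟩
  rw [← h, div_self hpos.ne'] at hvy
  exact hy.2.ne hvy.symm

/-- A larger power of the cosine gives less weight to the angles far from `0`. -/
theorem integral_cos_pow_ratio_le {p q : ℕ} (hpq : p ≤ q) {θ : ℝ}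
    (hθ : θ ∈ Set.Icc 0 (Real.pi / 2)) :
    (∫ x in θ..(Real.pi / 2), Real.cos x ^ q) / ∫ x in (0 : ℝ)..(Real.pi / 2), Real.cos x ^ q ≤
      (∫ x in θ..(Real.pi / 2), Real.cos x ^ p) /
        ∫ x in (0 : ℝ)..(Real.pi / 2), Real.cos x ^ p := by
  have hpos : ∀ m : ℕ, 0 < ∫ x in (0 : ℝ)..(Real.pi / 2), Real.cos x ^ m := fun m =>
    integral_cos_pow_pos m (by linarith [Real.pi_pos]) (by positivity) le_rfl
  have hsplit : ∀ m : ℕ, ∫ x in (0 : ℝ)..(Real.pi / 2), Real.cos x ^ m =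
      (∫ x in (0 : ℝ)..θ, Real.cos x ^ m) + ∫ x in θ..(Real.pi / 2), Real.cos x ^ m := fun m =>
    (intervalIntegral.integral_add_adjacent_intervals (intervalIntegrable_cos_pow m _ _)
      (intervalIntegrable_cos_pow m _ _)).symm
  have hnn : ∀ m : ℕ, ∀ a b : ℝ, 0 ≤ a → a ≤ b → b ≤ Real.pi / 2 →
      0 ≤ ∫ x in a..b, Real.cos x ^ m := fun m a b ha hab hb =>
    intervalIntegral.integral_nonneg hab fun x hx => pow_nonneg (Real.cos_nonneg_of_mem_Icc
      ⟨by linarith [hx.1, Real.pi_pos], hx.2.trans hb⟩) m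
  set c := Real.cos θ ^ (q - p)
  have hcosθ : 0 ≤ Real.cos θ :=
    Real.cos_nonneg_of_mem_Icc ⟨by linarith [hθ.1, Real.pi_pos], hθ.2⟩
  have hfac : ∀ x, Real.cos x ^ q = Real.cos x ^ (q - p) * Real.cos x ^ p := fun x => by
    rw [← pow_add, Nat.sub_add_cancel hpq]
  have hfar : ∫ x in θ..(Real.pi / 2), Real.cos x ^ q ≤
      c * ∫ x in θ..(Real.pi / 2), Real.cos x ^ p := by
    rw [← intervalIntegral.integral_const_mul]
    refine intervalIntegral.integral_mono_on hθ.2 (intervalIntegrable_cos_pow q _ _)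
      ((intervalIntegrable_cos_pow p _ _).const_mul c) fun x hx => ?_
    have hcx : 0 ≤ Real.cos x :=
      Real.cos_nonneg_of_mem_Icc ⟨by linarith [hθ.1, hx.1, Real.pi_pos], hx.2⟩
    rw [hfac]
    refine mul_le_mul_of_nonneg_right (pow_le_pow_left₀ hcx ?_ _) (pow_nonneg hcx _)
    exact Real.cos_le_cos_of_nonneg_of_le_pi hθ.1 (by linarith [hx.2, Real.pi_pos]) hx.1
  have hnear : c * ∫ x in (0 : ℝ)..θ, Real.cos x ^ p ≤ ∫ x in (0 : ℝ)..θ, Real.cos x ^ q := by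
    rw [← intervalIntegral.integral_const_mul]
    refine intervalIntegral.integral_mono_on hθ.1 ((intervalIntegrable_cos_pow p _ _).const_mul c)
      (intervalIntegrable_cos_pow q _ _) fun x hx => ?_
    have hcx : 0 ≤ Real.cos x :=
      Real.cos_nonneg_of_mem_Icc ⟨by linarith [hx.1, Real.pi_pos], hx.2.trans hθ.2⟩
    rw [hfac]
    refine mul_le_mul_of_nonneg_right (pow_le_pow_left₀ hcosθ ?_ _) (pow_nonneg hcx _)
    exact Real.cos_le_cos_of_nonneg_of_le_pi hx.1 (by linarith [hθ.2, Real.pi_pos]) hx.2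
  rw [div_le_div_iff₀ (hpos q) (hpos p), hsplit q, hsplit p, mul_add, mul_add,
    mul_comm (∫ x in θ..(Real.pi / 2), Real.cos x ^ p) (∫ x in θ..(Real.pi / 2), Real.cos x ^ q)]
  have h1 := hnn p 0 θ le_rfl hθ.1 hθ.2
  have h2 := hnn p θ (Real.pi / 2) hθ.1 hθ.2 le_rfl
  nlinarith [mul_le_mul_of_nonneg_right hfar h1, mul_le_mul_of_nonneg_right hnear h2]

/-! ### Volumes of sectors of the ball -/

section Sector

variable {W : Type*} [NormedAddCommGroup W]

/-- The points `(t, w)` of the unit ball of `ℝ × W`, with the Hilbert sum norm, whose angle to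
`W` lies in `A`. -/
def sector (W : Type*) [NormedAddCommGroup W] (A : Set ℝ) : Set (ℝ × W) :=
  {p | p.1 ^ 2 + ‖p.2‖ ^ 2 < 1 ∧ Real.arctan (p.1 / ‖p.2‖) ∈ A}

theorem measurableSet_sector [MeasurableSpace W] [OpensMeasurableSpace W] {A : Set ℝ}
    (hA : MeasurableSet A) : MeasurableSet (sector W A) := by
  have h1 : Measurable fun p : ℝ × W => ‖p.2‖ := measurable_norm.comp measurable_snd
  have h2 : Measurable fun p : ℝ × W => p.1 := measurable_fst
  exact MeasurableSet.inter (s₁ := {p : ℝ × W | p.1 ^ 2 + ‖p.2‖ ^ 2 < 1})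
    (measurableSet_lt ((h2.pow_const 2).add (h1.pow_const 2)) measurable_const)
    ((Real.continuous_arctan.measurable.comp (h2.div h1)) hA)

/-- The section of a sector at `w`, in the coordinate `φ` with `t = ‖w‖ tan φ`. -/
theorem volume_sector_section {A : Set ℝ} (hA : MeasurableSet A)
    (hAI : A ⊆ Set.Ioo (-(Real.pi / 2)) (Real.pi / 2)) {w : W} (hw : w ≠ 0) :
    volume ((fun t : ℝ => (t, w)) ⁻¹' sector W A) =
      ∫⁻ φ in A, ENNReal.ofReal ((Real.cos φ ^ 2)⁻¹) *
        (Metric.ball (0 : W) (Real.cos φ)).indicator (fun w => ENNReal.ofReal ‖w‖) w := by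
  have hr : 0 < ‖w‖ := norm_pos_iff.2 hw
  set f : ℝ → ℝ := fun φ => ‖w‖ * Real.tan φ
  have hf : ∀ φ, f φ / ‖w‖ = Real.tan φ := fun φ => mul_div_cancel_left₀ _ hr.ne'
  have hinj : Set.InjOn f A := fun x hx y hy hxy =>
    Real.injOn_tan (hAI hx) (hAI hy) (mul_left_cancel₀ hr.ne' hxy)
  have hD : MeasurableSet {t : ℝ | t ^ 2 + ‖w‖ ^ 2 < 1} :=
    measurableSet_lt (by fun_prop) measurable_const
  have hset : (fun t : ℝ => (t, w)) ⁻¹' sector W A = {t : ℝ | t ^ 2 + ‖w‖ ^ 2 < 1} ∩ f '' A := by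
    ext t
    refine and_congr_right fun _ => ⟨fun h => ⟨_, h, ?_⟩, ?_⟩
    · simp only [f, Real.tan_arctan]
      field_simp
    · rintro ⟨φ, hφ, rfl⟩
      rw [hf, Real.arctan_tan (hAI hφ).1 (hAI hφ).2]
      exact hφ
  have hcv := lintegral_image_eq_lintegral_abs_deriv_mul hA
    (f' := fun φ => ‖w‖ * (1 / Real.cos φ ^ 2))
    (fun φ hφ => ((Real.hasDerivAt_tan_of_mem_Ioo (hAI hφ)).const_mul ‖w‖).hasDerivWithinAt) hinj
    ({t : ℝ | t ^ 2 + ‖w‖ ^ 2 < 1}.indicator 1)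
  rw [lintegral_indicator_one hD, Measure.restrict_apply hD, ← hset] at hcv
  rw [hcv]
  refine setLIntegral_congr_fun hA fun φ hφ => ?_
  have hc : 0 < Real.cos φ := Real.cos_pos_of_mem_Ioo (hAI hφ)
  have hiff : f φ ∈ {t : ℝ | t ^ 2 + ‖w‖ ^ 2 < 1} ↔ w ∈ Metric.ball (0 : W) (Real.cos φ) := by
    have : f φ ^ 2 + ‖w‖ ^ 2 = (‖w‖ / Real.cos φ) ^ 2 := by
      simp only [f, Real.tan_eq_sin_div_cos]
      field_simp
      linear_combination Real.sin_sq_add_cos_sq φ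
    rw [Set.mem_ofPred_eq, this, mem_ball_zero_iff, sq_lt_one_iff₀ (by positivity),
      div_lt_one hc]
  by_cases hφw : w ∈ Metric.ball (0 : W) (Real.cos φ)
  · rw [Set.indicator_of_mem (hiff.2 hφw), Set.indicator_of_mem hφw, Pi.one_apply, mul_one,
      ← ENNReal.ofReal_mul (by positivity), abs_of_nonneg (by positivity)]
    congr 1
    rw [one_div, mul_comm]
  · rw [Set.indicator_of_notMem (fun h => hφw (hiff.1 h)), Set.indicator_of_notMem hφw]
    simp

variable [NormedSpace ℝ W] [FiniteDimensional ℝ W] [MeasurableSpace W] [BorelSpace W]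
  (ν : Measure W) [ν.IsAddHaarMeasure]

theorem lintegral_norm_ball {r : ℝ} (hr : 0 < r) :
    ∫⁻ w in Metric.ball (0 : W) r, ENNReal.ofReal ‖w‖ ∂ν =
      ENNReal.ofReal (r ^ (Module.finrank ℝ W + 1)) *
        ∫⁻ w in Metric.ball (0 : W) 1, ENNReal.ofReal ‖w‖ ∂ν := by
  have hmeas : Measurable ((Metric.ball (0 : W) r).indicator fun w => ENNReal.ofReal ‖w‖) :=
    (measurable_norm.ennreal_ofReal).indicator measurableSet_ball
  have h := lintegral_map (μ := ν) hmeas (measurable_const_smul r)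
  rw [Measure.map_addHaar_smul ν hr.ne', lintegral_smul_measure,
    lintegral_indicator measurableSet_ball] at h
  have h2 : ∀ w : W, (Metric.ball (0 : W) r).indicator (fun w => ENNReal.ofReal ‖w‖) (r • w) =
      ENNReal.ofReal r * (Metric.ball (0 : W) 1).indicator (fun w => ENNReal.ofReal ‖w‖) w := by
    intro w
    have hiff : r • w ∈ Metric.ball (0 : W) r ↔ w ∈ Metric.ball (0 : W) 1 := by
      rw [mem_ball_zero_iff, mem_ball_zero_iff, norm_smul, Real.norm_eq_abs, abs_of_pos hr,
        mul_lt_iff_lt_one_right hr]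
    by_cases hw : w ∈ Metric.ball (0 : W) 1
    · rw [Set.indicator_of_mem (hiff.2 hw), Set.indicator_of_mem hw, norm_smul,
        Real.norm_eq_abs, abs_of_pos hr, ENNReal.ofReal_mul hr.le]
    · rw [Set.indicator_of_notMem (fun h => hw (hiff.1 h)), Set.indicator_of_notMem hw, mul_zero]
  simp only [h2] at h
  rw [lintegral_const_mul' _ _ ENNReal.ofReal_ne_top, lintegral_indicator measurableSet_ball,
    abs_of_pos (by positivity), ENNReal.ofReal_inv_of_pos (by positivity), smul_eq_mul] at h
  have hpow : ENNReal.ofReal (r ^ Module.finrank ℝ W) ≠ 0 := by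
    rw [Ne, ENNReal.ofReal_eq_zero, not_le]; positivity
  rw [pow_succ, ENNReal.ofReal_mul (by positivity), mul_assoc, ← h, ← mul_assoc,
    ENNReal.mul_inv_cancel hpow ENNReal.ofReal_ne_top, one_mul]

/-- The volume of a sector is proportional to the integral over its angles of `cos ^ m`, where
`m + 1` is the dimension of `W`. -/
theorem volume_sector {m : ℕ} (hm : Module.finrank ℝ W = m + 1) {A : Set ℝ}
    (hA : MeasurableSet A) (hAI : A ⊆ Set.Ioo (-(Real.pi / 2)) (Real.pi / 2)) :
    ((volume : Measure ℝ).prod ν) (sector W A) =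
      (∫⁻ φ in A, ENNReal.ofReal (Real.cos φ ^ m)) *
        ∫⁻ w in Metric.ball (0 : W) 1, ENNReal.ofReal ‖w‖ ∂ν := by
  have hnt : Nontrivial W := Module.nontrivial_of_finrank_pos (R := ℝ) (by omega)
  have hne : ∀ᵐ w ∂ν, w ≠ 0 := by
    simp [ae_iff]
  have hmeas : Measurable fun p : W × ℝ => ENNReal.ofReal ((Real.cos p.2 ^ 2)⁻¹) *
      (Metric.ball (0 : W) (Real.cos p.2)).indicator (fun w => ENNReal.ofReal ‖w‖) p.1 := by
    refine Measurable.mul ?_ ?_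
    · exact ((Real.measurable_cos.comp measurable_snd).pow_const 2).inv.ennreal_ofReal
    · have hs : MeasurableSet {p : W × ℝ | ‖p.1‖ < Real.cos p.2} :=
        measurableSet_lt (measurable_norm.comp measurable_fst)
          (Real.measurable_cos.comp measurable_snd)
      convert! ((measurable_norm.comp measurable_fst).ennreal_ofReal).indicator hs using 1
      ext p
      simp only [Set.indicator, Set.mem_ofPred_eq, mem_ball_zero_iff, Function.comp_apply]
  rw [Measure.prod_apply_symm (measurableSet_sector hA),
    lintegral_congr_ae (hne.mono fun w hw => volume_sector_section hA hAI hw),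
    lintegral_lintegral_swap hmeas.aemeasurable, ← lintegral_mul_const _ (by fun_prop)]
  refine setLIntegral_congr_fun hA fun φ hφ => ?_
  have hc : 0 < Real.cos φ := Real.cos_pos_of_mem_Ioo (hAI hφ)
  rw [lintegral_const_mul' _ _ ENNReal.ofReal_ne_top, lintegral_indicator measurableSet_ball,
    lintegral_norm_ball ν hc, ← mul_assoc, ← ENNReal.ofReal_mul (by positivity), hm]
  congr 2
  field_simp
  ring

end Sector

theorem lintegral_cos_pow (m : ℕ) {a b : ℝ} (ha : -(Real.pi / 2) ≤ a) (hab : a ≤ b)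
    (hb : b ≤ Real.pi / 2) :
    ∫⁻ φ in Set.Ioo a b, ENNReal.ofReal (Real.cos φ ^ m) =
      ENNReal.ofReal (∫ x in a..b, Real.cos x ^ m) := by
  rw [intervalIntegral.integral_of_le hab, integral_Ioc_eq_integral_Ioo,
    ofReal_integral_eq_lintegral_ofReal]
  · exact (Continuous.integrableOn_Icc (by fun_prop)).mono_set Set.Ioo_subset_Icc_self
  · rw [EventuallyLE, ae_restrict_iff' measurableSet_Ioo]
    exact Eventually.of_forall fun x hx => pow_nonneg (Real.cos_nonneg_of_mem_Icc
      ⟨ha.trans hx.1.le, hx.2.le.trans hb⟩) m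

/-- Orthonormal coordinates adapted to a unit vector `u`. -/
theorem exists_measurePreserving_coordinates {k : ℕ} {u : EuclideanSpace ℝ (Fin (k + 1))}
    (hu : ‖u‖ = 1) :
    ∃ Ψ : EuclideanSpace ℝ (Fin (k + 1)) → ℝ × EuclideanSpace ℝ (Fin k),
      MeasurePreserving Ψ volume (volume.prod volume) ∧
      ∀ z, (Ψ z).1 = inner ℝ u z ∧ (Ψ z).1 ^ 2 + ‖(Ψ z).2‖ ^ 2 = ‖z‖ ^ 2 := by
  have hv : Orthonormal ℝ (Set.domRestrict {(0 : Fin (k + 1))}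
      (fun _ : Fin (k + 1) => u)) := by
    refine ⟨fun _ => hu, fun i j hij => absurd (Subsingleton.elim i j) hij⟩
  obtain ⟨b, hb⟩ := hv.exists_orthonormalBasis_extension_of_card_eq (by simp)
  have h1 := b.measurePreserving_repr
  have h2 := PiLp.volume_preserving_ofLp (Fin (k + 1))
  have h3 := volume_preserving_piFinSuccAbove (fun _ : Fin (k + 1) => ℝ) 0
  have h4 := (MeasurePreserving.id (volume : Measure ℝ)).prod (PiLp.volume_preserving_toLp (Fin k))
  refine ⟨_, h4.comp (h3.comp (h2.comp h1)), fun z => ?_⟩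
  have h0 : b.repr z 0 = inner ℝ u z := by
    rw [OrthonormalBasis.repr_apply_apply, hb 0 rfl]
  refine ⟨h0, ?_⟩
  rw [← b.repr.norm_map z, EuclideanSpace.norm_sq_eq, EuclideanSpace.norm_sq_eq, Fin.sum_univ_succ]
  simp [MeasurableEquiv.piFinSuccAbove, Fin.insertNthEquiv, Fin.tail_def]

/-- A lower bound for the proportion of the ball of dimension `m + 2` occupied by the double cap
around `u` of the vectors at angle more than `θ` from the hyperplane orthogonal to `u`. The angle to
this hyperplane has density proportional to `cos ^ m`; replacing `m` by `q ≥ m` concentrates it near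
`0` and can only decrease the proportion. -/
theorem volume_cap_ge {m q : ℕ} (hmq : m ≤ q) {u : EuclideanSpace ℝ (Fin (m + 2))}
    (hu : ‖u‖ = 1) {θ : ℝ} (hθ : θ ∈ Set.Icc 0 (Real.pi / 2)) :
    (∫ x in θ..(Real.pi / 2), Real.cos x ^ q) / (∫ x in (0 : ℝ)..(Real.pi / 2), Real.cos x ^ q) *
        volume.real (Metric.ball (0 : EuclideanSpace ℝ (Fin (m + 2))) 1) ≤
      volume.real {z ∈ Metric.ball (0 : EuclideanSpace ℝ (Fin (m + 2))) 1 |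
        Real.sin θ * ‖z‖ < |inner ℝ u z|} := by
  obtain ⟨Ψ, hΨ, hcoord⟩ := exists_measurePreserving_coordinates hu
  set K := ∫⁻ w in Metric.ball (0 : EuclideanSpace ℝ (Fin (m + 1))) 1, ENNReal.ofReal ‖w‖
  have hW : Module.finrank ℝ (EuclideanSpace ℝ (Fin (m + 1))) = m + 1 := by
    simp
  have hvol : ∀ a b : ℝ, -(Real.pi / 2) ≤ a → a ≤ b → b ≤ Real.pi / 2 →
      volume.real (Ψ ⁻¹' sector (EuclideanSpace ℝ (Fin (m + 1))) (Set.Ioo a b)) =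
        (∫ x in a..b, Real.cos x ^ m) * K.toReal := by
    intro a b ha hab hb
    rw [hΨ.measureReal_preimage (measurableSet_sector measurableSet_Ioo).nullMeasurableSet,
      measureReal_def, volume_sector volume hW measurableSet_Ioo (Set.Ioo_subset_Ioo ha hb),
      lintegral_cos_pow m ha hab hb, ENNReal.toReal_mul, ENNReal.toReal_ofReal]
    exact intervalIntegral.integral_nonneg hab fun x hx => pow_nonneg
      (Real.cos_nonneg_of_mem_Icc ⟨ha.trans hx.1, hx.2.trans hb⟩) m
  have hneg : ∀ t : ℝ, ∫ x in -(Real.pi / 2)..(-t), Real.cos x ^ m =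
      ∫ x in t..(Real.pi / 2), Real.cos x ^ m := fun t => by
    rw [← intervalIntegral.integral_comp_neg]
    simp
  have hball : Metric.ball (0 : EuclideanSpace ℝ (Fin (m + 2))) 1 =
      Ψ ⁻¹' sector (EuclideanSpace ℝ (Fin (m + 1))) (Set.Ioo (-(Real.pi / 2)) (Real.pi / 2)) := by
    ext z
    rw [mem_ball_zero_iff, Set.mem_preimage, sector, Set.mem_ofPred_eq, (hcoord z).2,
      sq_lt_one_iff₀ (norm_nonneg z)]
    exact (and_iff_left (Real.arctan_mem_Ioo _)).symm
  have hcap : ∀ A : Set ℝ, (∀ x ∈ A, θ < |x|) → Ψ ⁻¹' sector (EuclideanSpace ℝ (Fin (m + 1))) A ⊆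
      {z ∈ Metric.ball (0 : EuclideanSpace ℝ (Fin (m + 2))) 1 |
        Real.sin θ * ‖z‖ < |inner ℝ u z|} := by
    rintro A hA z ⟨hz1, hz2⟩
    rw [(hcoord z).2, sq_lt_one_iff₀ (norm_nonneg z)] at hz1
    refine ⟨mem_ball_zero_iff.2 hz1, ?_⟩
    rw [← (hcoord z).1]
    have hz0 := hA _ hz2
    set t := (Ψ z).1
    set r := ‖(Ψ z).2‖ with hr
    have hr0 : 0 < r := by
      refine lt_of_le_of_ne (norm_nonneg _) fun h => ?_
      rw [← h, div_zero, Real.arctan_zero, abs_zero] at hz0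
      exact absurd hθ.1 (not_le.2 hz0)
    have hsq : √(1 + (t / r) ^ 2) * r = ‖z‖ := by
      rw [← Real.sqrt_sq (norm_nonneg z), ← (hcoord z).2, ← Real.sqrt_sq hr0.le,
        ← Real.sqrt_mul (by positivity), Real.sqrt_sq hr0.le]
      congr 1
      field_simp
      ring
    have hsin : |Real.sin (Real.arctan (t / r))| * ‖z‖ = |t| := by
      rw [Real.sin_arctan, ← hsq, abs_div, abs_of_nonneg (Real.sqrt_nonneg _), abs_div,
        abs_of_pos hr0]
      have : 0 < √(1 + (t / r) ^ 2) := Real.sqrt_pos.2 (by positivity)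
      field_simp
    have hznorm : 0 < ‖z‖ := by rw [← hsq]; positivity
    rw [← hsin]
    refine mul_lt_mul_of_pos_right ?_ hznorm
    have h1 := Real.arctan_mem_Ioo (t / r)
    have h2 : |Real.arctan (t / r)| < Real.pi / 2 := abs_lt.2 h1
    rw [Real.abs_sin_eq_sin_abs_of_abs_le_pi (by linarith [Real.pi_pos])]
    exact Real.sin_lt_sin_of_lt_of_le_pi_div_two (by linarith [hθ.1, Real.pi_pos]) h2.le hz0
  have hpos := integral_cos_pow_pos m (a := 0) (b := Real.pi / 2) (by linarith [Real.pi_pos])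
    (by positivity) le_rfl
  have hfin : volume {z ∈ Metric.ball (0 : EuclideanSpace ℝ (Fin (m + 2))) 1 |
        Real.sin θ * ‖z‖ < |inner ℝ u z|} ≠ ⊤ :=
    ((measure_mono fun z hz => hz.1).trans_lt measure_ball_lt_top).ne
  have hdisj : Disjoint
      (Ψ ⁻¹' sector (EuclideanSpace ℝ (Fin (m + 1))) (Set.Ioo (-(Real.pi / 2)) (-θ)))
      (Ψ ⁻¹' sector (EuclideanSpace ℝ (Fin (m + 1))) (Set.Ioo θ (Real.pi / 2))) := by
    rw [Set.disjoint_left]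
    rintro z ⟨-, h1⟩ ⟨-, h2⟩
    linarith [h1.2, h2.1, hθ.1]
  have hunion : 2 * (∫ x in θ..(Real.pi / 2), Real.cos x ^ m) * K.toReal ≤
      volume.real {z ∈ Metric.ball (0 : EuclideanSpace ℝ (Fin (m + 2))) 1 |
        Real.sin θ * ‖z‖ < |inner ℝ u z|} := by
    have hsub1 := hcap (Set.Ioo (-(Real.pi / 2)) (-θ)) fun x hx => by
      rw [abs_of_neg (by linarith [hx.2, hθ.1])]; linarith [hx.2]
    have hsub2 := hcap (Set.Ioo θ (Real.pi / 2)) fun x hx => hx.1.trans_le (le_abs_self x)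
    have := measureReal_mono (Set.union_subset hsub1 hsub2) hfin
    rw [measureReal_union hdisj (hΨ.measurable (measurableSet_sector measurableSet_Ioo))
        (measure_ne_top_of_subset hsub1 hfin) (measure_ne_top_of_subset hsub2 hfin),
      hvol _ _ le_rfl (by linarith [hθ.2]) (by linarith [hθ.1, Real.pi_pos]),
      hvol _ _ (by linarith [hθ.1, Real.pi_pos]) hθ.2 le_rfl, hneg] at this
    linarith
  have hfull : volume.real (Metric.ball (0 : EuclideanSpace ℝ (Fin (m + 2))) 1) =
      2 * (∫ x in (0 : ℝ)..(Real.pi / 2), Real.cos x ^ m) * K.toReal := by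
    have h0 := hneg 0
    rw [neg_zero] at h0
    rw [hball, hvol _ _ le_rfl (by linarith [Real.pi_pos]) le_rfl,
      ← intervalIntegral.integral_add_adjacent_intervals (intervalIntegrable_cos_pow m _ 0)
        (intervalIntegrable_cos_pow m _ _), h0]
    ring
  refine le_trans ?_ hunion
  rw [hfull]
  calc _ ≤ (∫ x in θ..(Real.pi / 2), Real.cos x ^ m) /
        (∫ x in (0 : ℝ)..(Real.pi / 2), Real.cos x ^ m) *
        (2 * (∫ x in (0 : ℝ)..(Real.pi / 2), Real.cos x ^ m) * K.toReal) :=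
        mul_le_mul_of_nonneg_right (integral_cos_pow_ratio_le hmq hθ)
          (mul_nonneg (by linarith) ENNReal.toReal_nonneg)
    _ = _ := by
        field_simp

open scoped Pointwise

/-! ### Quadratic forms of positive definite matrices -/

section QuadForm

variable {n : ℕ}

theorem quadForm_nonneg {P : Matrix (Fin n) (Fin n) ℝ} (hP : P.PosSemidef) (v : Fin n → ℝ) :
    0 ≤ quadForm P v := by
  simpa [quadForm] using hP.dotProduct_mulVec_nonneg v

theorem quadForm_pos {P : Matrix (Fin n) (Fin n) ℝ} (hP : P.PosDef) {v : Fin n → ℝ} (hv : v ≠ 0) :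
    0 < quadForm P v := by
  simpa [quadForm] using hP.dotProduct_mulVec_pos hv

theorem quadForm_smul_vec (P : Matrix (Fin n) (Fin n) ℝ) (c : ℝ) (v : Fin n → ℝ) :
    quadForm P (c • v) = c ^ 2 * quadForm P v := by
  simp only [quadForm, Matrix.mulVec_smul, smul_dotProduct, dotProduct_smul, smul_eq_mul]
  ring

theorem quadForm_one_ofLp (v : EuclideanSpace ℝ (Fin n)) :
    quadForm 1 v.ofLp = ‖v‖ ^ 2 := by
  rw [EuclideanSpace.norm_sq_eq]
  simp [quadForm, dotProduct, sq]

theorem quadForm_smul_one_ofLp (c : ℝ) (v : EuclideanSpace ℝ (Fin n)) :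
    quadForm (c • 1) v.ofLp = c * ‖v‖ ^ 2 := by
  rw [← quadForm_one_ofLp]
  simp [quadForm, Matrix.smul_mulVec]

theorem quadForm_sub (P Q : Matrix (Fin n) (Fin n) ℝ) (v : Fin n → ℝ) :
    quadForm (P - Q) v = quadForm P v - quadForm Q v := by
  simp [quadForm, Matrix.sub_mulVec, dotProduct_sub]

theorem posDef_of_one_le {P : Matrix (Fin n) (Fin n) ℝ} (hP : (P - 1).PosSemidef) : P.PosDef := by
  have := Matrix.PosDef.posSemidef_add hP Matrix.PosDef.one
  rwa [sub_add_cancel] at this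

open scoped MatrixOrder in
theorem exists_transpose_mul_self_eq {P : Matrix (Fin n) (Fin n) ℝ} (hP : P.PosSemidef) :
    ∃ B : Matrix (Fin n) (Fin n) ℝ, P = B.transpose * B := by
  obtain ⟨B, hB⟩ := CStarAlgebra.nonneg_iff_eq_star_mul_self.1 (Matrix.nonneg_iff_posSemidef.2 hP)
  exact ⟨B, by rw [hB, Matrix.star_eq_conjTranspose, Matrix.conjTranspose_eq_transpose_of_trivial]⟩

theorem quadForm_transpose_mul_self (B : Matrix (Fin n) (Fin n) ℝ)
    (v : EuclideanSpace ℝ (Fin n)) :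
    quadForm (B.transpose * B) v.ofLp =
      ‖Matrix.toEuclideanCLM (n := Fin n) (𝕜 := ℝ) B v‖ ^ 2 := by
  rw [← quadForm_one_ofLp, Matrix.ofLp_toEuclideanCLM, quadForm, quadForm, Matrix.one_mulVec,
    ← Matrix.mulVec_mulVec, Matrix.dotProduct_mulVec, Matrix.vecMul_transpose]

open scoped MatrixOrder in
theorem lambdaMin_mul_sq_le {P : Matrix (Fin n) (Fin n) ℝ} (hP : P.IsHermitian)
    (v : EuclideanSpace ℝ (Fin n)) : lambdaMin P * ‖v‖ ^ 2 ≤ quadForm P v.ofLp := by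
  have hbdd : BddBelow (spectrum ℝ P) := by
    rw [hP.spectrum_real_eq_range_eigenvalues]
    exact (Set.finite_range _).bddBelow
  have hle : algebraMap ℝ _ (lambdaMin P) ≤ P :=
    algebraMap_le_of_le_spectrum (fun x hx => csInf_le hbdd hx) hP
  have h := quadForm_nonneg (Matrix.le_iff.1 hle) v.ofLp
  rw [Algebra.algebraMap_eq_smul_one, quadForm_sub, quadForm_smul_one_ofLp] at h
  linarith

theorem lambdaMin_pos (hn : 0 < n) {P : Matrix (Fin n) (Fin n) ℝ} (hP : P.PosDef) :
    0 < lambdaMin P := by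
  have : Nonempty (Fin n) := ⟨⟨0, hn⟩⟩
  rw [lambdaMin, hP.1.spectrum_real_eq_range_eigenvalues]
  obtain ⟨i, hi⟩ := (Set.range_nonempty hP.1.eigenvalues).csInf_mem (Set.finite_range _)
  rw [← hi]
  exact hP.eigenvalues_pos i

end QuadForm

/-! ### Cones, their volumes, and linear images -/

section Cone

variable {n : ℕ}

/-- The normalized surface measure of the trace of a cone on the sphere is the proportion of the
unit ball that the cone occupies. -/
theorem sphereUniform_cone (hn : 0 < n) {E : Set (EuclideanSpace ℝ (Fin n))}
    (hE : MeasurableSet E) (h0 : (0 : EuclideanSpace ℝ (Fin n)) ∉ E)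
    (hcone : ∀ c : ℝ, 0 < c → ∀ z, c • z ∈ E ↔ z ∈ E) :
    (sphereUniform n).real {x : Sphere n | x.1 ∈ E} =
      volume.real (E ∩ Metric.ball 0 1) /
        volume.real (Metric.ball (0 : EuclideanSpace ℝ (Fin n)) 1) := by
  have hset : Set.Ioo (0 : ℝ) 1 • ((↑) '' {x : Sphere n | x.1 ∈ E} :
      Set (EuclideanSpace ℝ (Fin n))) = E ∩ Metric.ball 0 1 := by
    ext z
    constructor
    · rintro ⟨c, hc, _, ⟨x, hx, rfl⟩, rfl⟩
      refine ⟨(hcone c hc.1 _).2 hx, ?_⟩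
      rw [mem_ball_zero_iff]
      simp only [norm_smul, Real.norm_eq_abs, abs_of_pos hc.1, norm_eq_of_mem_sphere, mul_one]
      exact hc.2
    · rintro ⟨hz, hzb⟩
      have hz0 : z ≠ 0 := fun h => h0 (h ▸ hz)
      have hzn : 0 < ‖z‖ := norm_pos_iff.2 hz0
      rw [mem_ball_zero_iff] at hzb
      refine ⟨‖z‖, ⟨hzn, hzb⟩, ‖z‖⁻¹ • z, ⟨⟨‖z‖⁻¹ • z, ?_⟩, ?_, rfl⟩, ?_⟩
      · rw [mem_sphere_zero_iff_norm, norm_smul, norm_inv, norm_norm, inv_mul_cancel₀ hzn.ne']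
      · exact (hcone _ (inv_pos.2 hzn) z).2 hz
      · simp only
        rw [smul_smul, mul_inv_cancel₀ hzn.ne', one_smul]
  have hmeas : MeasurableSet {x : Sphere n | x.1 ∈ E} := measurable_subtype_coe hE
  have hn' : (n : ENNReal) ≠ 0 := by exact_mod_cast hn.ne'
  rw [measureReal_def, sphereUniform, Measure.smul_apply, smul_eq_mul, ENNReal.toReal_mul,
    ENNReal.toReal_inv, Measure.toSphere_apply' _ hmeas, Measure.toSphere_apply_univ, hset,
    ENNReal.toReal_mul, ENNReal.toReal_mul, finrank_euclideanSpace_fin, ← measureReal_def,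
    ← measureReal_def, ENNReal.toReal_natCast]
  have : (n : ℝ) ≠ 0 := by exact_mod_cast hn.ne'
  field_simp

theorem det_toEuclideanCLM (B : Matrix (Fin n) (Fin n) ℝ) :
    LinearMap.det (Matrix.toEuclideanCLM (n := Fin n) (𝕜 := ℝ) B :
      EuclideanSpace ℝ (Fin n) →ₗ[ℝ] EuclideanSpace ℝ (Fin n)) = B.det := by
  rw [Matrix.coe_toEuclideanCLM_eq_toEuclideanLin]
  simp

/-- The linear map `B` with `BᵀB = P` increases the proportion of the unit ball occupied by a
cone at most by the factor `κ(P)`. -/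
theorem volume_image_cone_le (hn : 0 < n) {B : Matrix (Fin n) (Fin n) ℝ}
    (hP : (B.transpose * B).PosDef) {E : Set (EuclideanSpace ℝ (Fin n))}
    (hcone : ∀ c : ℝ, 0 < c → ∀ z, c • z ∈ E ↔ z ∈ E) :
    volume.real (Matrix.toEuclideanCLM (n := Fin n) (𝕜 := ℝ) B '' E ∩ Metric.ball 0 1) ≤
      kappa (B.transpose * B) * volume.real (E ∩ Metric.ball 0 1) := by
  set T := Matrix.toEuclideanCLM (n := Fin n) (𝕜 := ℝ) B with hT
  set P := B.transpose * B with hPdef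
  set s := √(lambdaMin P) with hs
  have hlam := lambdaMin_pos hn hP
  have hs0 : 0 < s := Real.sqrt_pos.2 hlam
  have hsub : T '' E ∩ Metric.ball 0 1 ⊆ T '' (s⁻¹ • (E ∩ Metric.ball 0 1)) := by
    rintro _ ⟨⟨z, hz, rfl⟩, hb⟩
    refine ⟨z, ?_, rfl⟩
    rw [Set.mem_inv_smul_set_iff₀ hs0.ne']
    refine ⟨(hcone s hs0 z).2 hz, ?_⟩
    rw [mem_ball_zero_iff] at hb ⊢
    refine lt_of_le_of_lt ?_ hb
    have h1 := lambdaMin_mul_sq_le hP.1 z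
    rw [quadForm_transpose_mul_self] at h1
    refine abs_le_of_sq_le_sq' ?_ (norm_nonneg _) |>.2
    rw [norm_smul, mul_pow, Real.norm_eq_abs, sq_abs, Real.sq_sqrt hlam.le]
    exact h1
  have hvol : volume (T '' (s⁻¹ • (E ∩ Metric.ball 0 1))) =
      ENNReal.ofReal (|B.det| * (s⁻¹) ^ n) * volume (E ∩ Metric.ball 0 1) := by
    rw [Measure.addHaar_image_continuousLinearMap, det_toEuclideanCLM, Measure.addHaar_smul,
      finrank_euclideanSpace_fin, ← mul_assoc, ← ENNReal.ofReal_mul (abs_nonneg _),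
      abs_of_pos (by positivity : 0 < s⁻¹ ^ n)]
  have hkappa : kappa P = |B.det| * (s⁻¹) ^ n := by
    rw [kappa, hPdef, Matrix.det_mul, Matrix.det_transpose, ← hPdef,
      Real.sqrt_div (mul_self_nonneg _), Real.sqrt_mul_self_eq_abs, inv_pow, div_eq_mul_inv, hs]
    congr 2
    rw [← Real.sqrt_sq (pow_nonneg (Real.sqrt_nonneg _) n), ← pow_mul, mul_comm n 2, pow_mul,
      Real.sq_sqrt hlam.le]
  have hfin : volume (E ∩ Metric.ball (0 : EuclideanSpace ℝ (Fin n)) 1) ≠ ⊤ :=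
    measure_ne_top_of_subset Set.inter_subset_right measure_ball_lt_top.ne
  have hfin' : volume (T '' (s⁻¹ • (E ∩ Metric.ball 0 1))) ≠ ⊤ := by
    rw [hvol]
    exact ENNReal.mul_ne_top ENNReal.ofReal_ne_top hfin
  refine (measureReal_mono hsub hfin').trans_eq ?_
  rw [measureReal_def, hvol, ENNReal.toReal_mul, ENNReal.toReal_ofReal (by positivity), hkappa,
    measureReal_def]

end Cone

/-! ### From cones of violation to the joint spectral radius -/

/-- If the cone on which `A` fails to contract the norm `‖B ·‖` by `γ` is small, then its image
under `B` contains no double cap slightly larger than the one given by the inverse beta function.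
This bounds the operator norm of `M = B A B⁻¹`: for `w = Mᵀ v` some vector `z` with
`‖M z‖ ≤ γ ‖z‖` lies in the double cap around `w`, and `⟪w, z⟫ = ⟪v, M z⟫`. -/
theorem norm_conj_le_of_cone_small {m q : ℕ} (hmq : m ≤ q)
    {A B : Matrix (Fin (m + 2)) (Fin (m + 2)) ℝ} (hP : (B.transpose * B).PosDef)
    {γ y : ℝ} (hγ : 0 ≤ γ) (hy : y ∈ Set.Ico (0 : ℝ) 1)
    (hsmall : kappa (B.transpose * B) *
      volume.real ({z : EuclideanSpace ℝ (Fin (m + 2)) |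
          γ ^ 2 * quadForm (B.transpose * B) z.ofLp <
            quadForm (B.transpose * B) (A.mulVec z.ofLp)} ∩ Metric.ball 0 1) ≤
        y * volume.real (Metric.ball (0 : EuclideanSpace ℝ (Fin (m + 2))) 1)) :
    ‖Matrix.toEuclideanCLM (n := Fin (m + 2)) (𝕜 := ℝ) (B * A * B⁻¹)‖ ≤
      γ / √(1 - regIncBetaInv y (((q : ℝ) + 1) / 2) (1 / 2)) := by
  obtain ⟨θ₀, hθ₀, hinv, hratio⟩ := exists_regIncBetaInv_eq_cos_sq q hy
  have hsin : 0 < Real.sin θ₀ :=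
    Real.sin_pos_of_pos_of_lt_pi hθ₀.1 (by linarith [hθ₀.2, Real.pi_pos])
  rw [hinv, ← Real.sin_sq, Real.sqrt_sq hsin.le]
  set E : Set (EuclideanSpace ℝ (Fin (m + 2))) := {z |
    γ ^ 2 * quadForm (B.transpose * B) z.ofLp < quadForm (B.transpose * B) (A.mulVec z.ofLp)}
  have hcone : ∀ c : ℝ, 0 < c → ∀ z, c • z ∈ E ↔ z ∈ E := by
    intro c hc z
    simp only [E, Set.mem_ofPred_eq, WithLp.ofLp_smul, Matrix.mulVec_smul, quadForm_smul_vec]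
    rw [mul_left_comm, mul_lt_mul_iff_right₀ (by positivity)]
  have hBdet : IsUnit B.det := by
    have := hP.det_pos
    rw [Matrix.det_mul, Matrix.det_transpose] at this
    exact isUnit_iff_ne_zero.2 fun h => by simp [h] at this
  set T := Matrix.toEuclideanCLM (n := Fin (m + 2)) (𝕜 := ℝ) with hT
  set M := T (B * A * B⁻¹) with hM
  have hvolE : volume.real (T B '' E ∩ Metric.ball 0 1) ≤
      y * volume.real (Metric.ball (0 : EuclideanSpace ℝ (Fin (m + 2))) 1) :=
    (volume_image_cone_le (by omega) hP hcone).trans hsmall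
  have hballpos : 0 < volume.real (Metric.ball (0 : EuclideanSpace ℝ (Fin (m + 2))) 1) :=
    ENNReal.toReal_pos (Metric.measure_ball_pos _ _ one_pos).ne' measure_ball_lt_top.ne
  have hBB : ∀ z, T B (T B⁻¹ z) = z := fun z => by
    rw [← mul_apply_eq_comp, ← map_mul, Matrix.mul_nonsing_inv _ hBdet, map_one,
      one_apply_eq_self]
  -- Outside the image cone `M` contracts by `γ`.
  have hcontr : ∀ z, z ∉ T B '' E → ‖M z‖ ≤ γ * ‖z‖ := by
    intro z hz
    have hx : T B⁻¹ z ∉ E := fun h => hz ⟨_, h, hBB z⟩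
    simp only [E, Set.mem_ofPred_eq, not_lt] at hx
    have h1 : A.mulVec (T B⁻¹ z).ofLp = (T A (T B⁻¹ z)).ofLp := rfl
    have h2 : T B (T A (T B⁻¹ z)) = M z := by
      rw [hM, map_mul, map_mul]; rfl
    rw [h1, quadForm_transpose_mul_self, quadForm_transpose_mul_self, hBB, h2, ← mul_pow] at hx
    exact (abs_le_of_sq_le_sq' hx (by positivity)).2
  have hstar : ∀ v, ‖star M v‖ * Real.sin θ₀ ≤ γ * ‖v‖ := by
    intro v
    by_cases hw : star M v = 0
    · rw [hw, norm_zero, zero_mul]; positivity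
    have hwn : 0 < ‖star M v‖ := norm_pos_iff.2 hw
    -- At `θ₀` itself the cap may have exactly the volume of the cone, so it is slightly enlarged.
    have hstep : ∀ θ ∈ Set.Ioo 0 θ₀, ‖star M v‖ * Real.sin θ ≤ γ * ‖v‖ := by
      intro θ hθ
      have hu : ‖(‖star M v‖⁻¹ • star M v)‖ = 1 := by
        rw [norm_smul, norm_inv, norm_norm, inv_mul_cancel₀ hwn.ne']
      have hcap := volume_cap_ge hmq hu (θ := θ) ⟨hθ.1.le, hθ.2.le.trans hθ₀.2⟩
      have hlt : y < (∫ x in θ..(Real.pi / 2), Real.cos x ^ q) /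
          ∫ x in (0 : ℝ)..(Real.pi / 2), Real.cos x ^ q := by
        rw [← hratio]
        refine div_lt_div_of_pos_right ?_ (integral_cos_pow_pos q (by linarith [Real.pi_pos])
          (by positivity) le_rfl)
        rw [← intervalIntegral.integral_add_adjacent_intervals
          (intervalIntegrable_cos_pow q θ θ₀) (intervalIntegrable_cos_pow q θ₀ _)]
        have := integral_cos_pow_pos q (a := θ) (b := θ₀) (by linarith [hθ.1, Real.pi_pos])
          hθ.2 hθ₀.2
        linarith
      have hvol := (hvolE.trans_lt (mul_lt_mul_of_pos_right hlt hballpos)).trans_le hcap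
      have hnot : ¬ {z ∈ Metric.ball (0 : EuclideanSpace ℝ (Fin (m + 2))) 1 |
          Real.sin θ * ‖z‖ < |inner ℝ (‖star M v‖⁻¹ • star M v) z|} ⊆
          T B '' E ∩ Metric.ball 0 1 := fun hsub =>
        hvol.not_ge (measureReal_mono hsub
          (measure_ne_top_of_subset Set.inter_subset_right measure_ball_lt_top.ne))
      obtain ⟨z, ⟨hzb, hz⟩, hzE⟩ := Set.not_subset.1 hnot
      have hzE' : z ∉ T B '' E := fun h => hzE ⟨h, hzb⟩
      have hz0 : 0 < ‖z‖ := by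
        refine norm_pos_iff.2 fun h => ?_
        rw [h, inner_zero_right, norm_zero, mul_zero, abs_zero] at hz
        exact lt_irrefl _ hz
      rw [real_inner_smul_left, abs_mul, abs_inv, abs_norm, ContinuousLinearMap.star_eq_adjoint,
        ContinuousLinearMap.adjoint_inner_left, ← ContinuousLinearMap.star_eq_adjoint,
        lt_inv_mul_iff₀ hwn] at hz
      have h1 := abs_real_inner_le_norm v (M z)
      have h2 := mul_le_mul_of_nonneg_left (hcontr z hzE') (norm_nonneg v)
      have h3 : ‖star M v‖ * Real.sin θ * ‖z‖ ≤ γ * ‖v‖ * ‖z‖ := by linarith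
      exact le_of_mul_le_mul_right h3 hz0
    have hlim : Tendsto (fun θ => ‖star M v‖ * Real.sin θ) (nhdsWithin θ₀ (Set.Iio θ₀))
        (nhds (‖star M v‖ * Real.sin θ₀)) :=
      ((by fun_prop : Continuous fun θ => ‖star M v‖ * Real.sin θ).tendsto θ₀).mono_left
        nhdsWithin_le_nhds
    refine le_of_tendsto hlim ?_
    filter_upwards [Ioo_mem_nhdsLT hθ₀.1] with θ hθ using hstep θ hθ
  rw [← norm_star]
  refine ContinuousLinearMap.opNorm_le_bound _ (by positivity) fun v => ?_
  rw [div_mul_eq_mul_div, le_div_iff₀ hsin]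
  exact hstar v

/-- A common bound on the norms of simultaneous conjugates bounds the joint spectral radius. -/
theorem jointSpectralRadius_le_of_conj {n : ℕ} {𝒜 : Finset (Matrix (Fin n) (Fin n) ℝ)}
    {B : Matrix (Fin n) (Fin n) ℝ} (hB : IsUnit B.det) {R : ℝ} (hR : 0 ≤ R)
    (h : ∀ A ∈ 𝒜, ‖Matrix.toEuclideanCLM (n := Fin n) (𝕜 := ℝ) (B * A * B⁻¹)‖ ≤ R) :
    jointSpectralRadius 𝒜 ≤ R := by
  set T := Matrix.toEuclideanCLM (n := Fin n) (𝕜 := ℝ)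
  have hlist : ∀ l : List (Matrix (Fin n) (Fin n) ℝ), (∀ A ∈ l, A ∈ 𝒜) →
      ‖T (B * l.prod * B⁻¹)‖ ≤ R ^ l.length := by
    intro l
    induction l with
    | nil =>
      intro _
      rw [List.prod_nil, mul_one, Matrix.mul_nonsing_inv _ hB, map_one]
      exact ContinuousLinearMap.norm_id_le
    | cons A l ih =>
      intro hl
      have : B * (A :: l).prod * B⁻¹ = (B * A * B⁻¹) * (B * l.prod * B⁻¹) := by
        rw [List.prod_cons]
        simp only [Matrix.mul_assoc]
        rw [Matrix.nonsing_inv_mul_cancel_left _ _ hB]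
      rw [this, map_mul, List.length_cons, pow_succ']
      exact (norm_mul_le _ _).trans (mul_le_mul (h A (hl A (by simp)))
        (ih fun A' hA' => hl A' (by simp [hA'])) (norm_nonneg _) hR)
  set K := ‖T B⁻¹‖ * ‖T B‖ + 1 with hKdef
  have hK : 0 < K := by positivity
  have hprod : ∀ l : List (Matrix (Fin n) (Fin n) ℝ), (∀ A ∈ l, A ∈ 𝒜) →
      ‖T l.prod‖ ≤ K * R ^ l.length := by
    intro l hl
    have h1 : l.prod = B⁻¹ * (B * l.prod * B⁻¹) * B := by
      simp only [Matrix.mul_assoc]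
      rw [Matrix.nonsing_inv_mul _ hB, Matrix.mul_one, Matrix.nonsing_inv_mul_cancel_left _ _ hB]
    rw [h1, map_mul, map_mul]
    have h2 := hlist l hl
    have h3 : ‖T B⁻¹ * T (B * l.prod * B⁻¹) * T B‖ ≤ ‖T B⁻¹‖ * R ^ l.length * ‖T B‖ :=
      (norm_mul_le _ _).trans (mul_le_mul_of_nonneg_right ((norm_mul_le _ _).trans
        (mul_le_mul_of_nonneg_left h2 (norm_nonneg _))) (norm_nonneg _))
    have h4 : 0 ≤ R ^ l.length := by positivity
    rw [hKdef]
    linarith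
  have hnn : ∀ k, 0 ≤ maxProdNorm 𝒜 k := fun k => Real.iSup_nonneg fun w => norm_nonneg _
  have hmax : ∀ k, maxProdNorm 𝒜 k ≤ K * R ^ k := fun k => by
    refine Real.iSup_le (fun w => ?_) (by positivity)
    have := hprod (List.ofFn fun i => (w i : Matrix (Fin n) (Fin n) ℝ)) fun A hA => by
      obtain ⟨i, rfl⟩ := (List.mem_ofFn' _ _).1 hA
      exact (w i).2
    rwa [List.length_ofFn] at this
  have hle : ∀ᶠ k : ℕ in atTop,
      maxProdNorm 𝒜 k ^ (1 / (k : ℝ)) ≤ K ^ (1 / (k : ℝ)) * R := by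
    filter_upwards [eventually_gt_atTop 0] with k hk
    refine (Real.rpow_le_rpow (hnn k) (hmax k) (by positivity)).trans_eq ?_
    rw [Real.mul_rpow hK.le (by positivity), one_div, Real.pow_rpow_inv_natCast hR hk.ne']
  have hlim : Tendsto (fun k : ℕ => K ^ (1 / (k : ℝ)) * R) atTop (nhds R) := by
    have h1 : Tendsto (fun k : ℕ => K ^ (1 / (k : ℝ))) atTop (nhds (K ^ (0 : ℝ))) :=
      (Real.continuous_const_rpow hK.ne').continuousAt.tendsto.comp
        tendsto_one_div_atTop_nhds_zero_nat
    simpa using h1.mul_const R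
  rw [← hlim.limsup_eq]
  refine limsup_le_limsup hle ?_ hlim.isBoundedUnder_le
  exact isCoboundedUnder_le_of_le atTop (x := 0) fun k => Real.rpow_nonneg (hnn k) _

/-! ### Feasible matrices -/

section Feasible

variable {n : ℕ}

theorem frobeniusNorm_sq (P : Matrix (Fin n) (Fin n) ℝ) :
    frobeniusNorm P ^ 2 = ∑ i, ∑ j, P i j ^ 2 := by
  rw [frobeniusNorm, Matrix.frobenius_norm_def, ← Real.sqrt_eq_rpow, Real.sq_sqrt (by positivity)]
  simp

theorem frobeniusNorm_nonneg (P : Matrix (Fin n) (Fin n) ℝ) : 0 ≤ frobeniusNorm P := by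
  rw [frobeniusNorm, Matrix.frobenius_norm_def]
  positivity

theorem frobeniusNorm_eq_sqrt (P : Matrix (Fin n) (Fin n) ℝ) :
    frobeniusNorm P = √(∑ i, ∑ j, P i j ^ 2) := by
  rw [← frobeniusNorm_sq, Real.sqrt_sq (frobeniusNorm_nonneg P)]

@[fun_prop]
theorem continuous_frobeniusNorm :
    Continuous (frobeniusNorm : Matrix (Fin n) (Fin n) ℝ → ℝ) := by
  rw [funext frobeniusNorm_eq_sqrt]
  fun_prop

section
attribute [local instance] Matrix.frobeniusNormedAddCommGroup Matrix.frobeniusNormedSpace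

theorem frobeniusNorm_combination_le (P Q : Matrix (Fin n) (Fin n) ℝ) {a b : ℝ} (ha : 0 ≤ a)
    (hb : 0 ≤ b) :
    frobeniusNorm (a • P + b • Q) ≤ a * frobeniusNorm P + b * frobeniusNorm Q := by
  refine (norm_add_le _ _).trans_eq ?_
  rw [norm_smul, norm_smul, Real.norm_of_nonneg ha, Real.norm_of_nonneg hb]
  rfl

end

theorem convex_frobeniusNorm_lt (r : ℝ) :
    Convex ℝ {P : Matrix (Fin n) (Fin n) ℝ | frobeniusNorm P < r} := by
  intro P hP Q hQ a b ha hb hab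
  simp only [Set.mem_ofPred_eq] at *
  refine (frobeniusNorm_combination_le P Q ha hb).trans_lt ?_
  rcases ha.eq_or_lt with rfl | ha
  · rw [zero_add] at hab
    simpa [hab] using hQ
  · have h1 := mul_lt_mul_of_pos_left hP ha
    have h2 := mul_le_mul_of_nonneg_left hQ.le hb
    have h3 : a * r + b * r = r := by rw [← add_mul, hab, one_mul]
    linarith

theorem convex_frobeniusNorm_le (r : ℝ) :
    Convex ℝ {P : Matrix (Fin n) (Fin n) ℝ | frobeniusNorm P ≤ r} := by
  intro P hP Q hQ a b ha hb hab
  simp only [Set.mem_ofPred_eq] at *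
  refine (frobeniusNorm_combination_le P Q ha hb).trans ?_
  have h1 := mul_le_mul_of_nonneg_left hP ha
  have h2 := mul_le_mul_of_nonneg_left hQ hb
  have h3 : a * r + b * r = r := by rw [← add_mul, hab, one_mul]
  linarith

theorem frobeniusNorm_convexComb_lt {P Q : Matrix (Fin n) (Fin n) ℝ}
    (h : frobeniusNorm Q < frobeniusNorm P) {t : ℝ} (ht : 0 < t) (ht1 : t ≤ 1) :
    frobeniusNorm ((1 - t) • P + t • Q) < frobeniusNorm P := by
  have h1 := frobeniusNorm_combination_le P Q (sub_nonneg.2 ht1) ht.le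
  nlinarith

/-- Strict convexity of the squared Frobenius norm. -/
theorem frobeniusNorm_midpoint_lt {P Q : Matrix (Fin n) (Fin n) ℝ} (hne : P ≠ Q)
    (h : frobeniusNorm P ^ 2 = frobeniusNorm Q ^ 2) :
    frobeniusNorm ((1 / 2 : ℝ) • P + (1 / 2 : ℝ) • Q) ^ 2 < frobeniusNorm P ^ 2 := by
  have hpar : frobeniusNorm ((1 / 2 : ℝ) • P + (1 / 2 : ℝ) • Q) ^ 2 =
      (frobeniusNorm P ^ 2 + frobeniusNorm Q ^ 2) / 2 - ∑ i, ∑ j, (P i j - Q i j) ^ 2 / 4 := by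
    simp only [frobeniusNorm_sq, ← Finset.sum_add_distrib, Finset.sum_div,
      ← Finset.sum_sub_distrib]
    refine Finset.sum_congr rfl fun i _ => Finset.sum_congr rfl fun j _ => ?_
    simp only [Matrix.add_apply, Matrix.smul_apply, smul_eq_mul]
    ring
  obtain ⟨i, j, hij⟩ : ∃ i j, P i j ≠ Q i j := by
    by_contra hall
    push Not at hall
    exact hne (Matrix.ext hall)
  have hpos : 0 < ∑ i, ∑ j, (P i j - Q i j) ^ 2 / 4 := by
    refine Finset.sum_pos' (fun i _ => Finset.sum_nonneg fun j _ => by positivity)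
      ⟨i, Finset.mem_univ i, Finset.sum_pos' (fun j _ => by positivity) ⟨j, Finset.mem_univ j, ?_⟩⟩
    have := sq_pos_of_ne_zero (sub_ne_zero.2 hij)
    positivity
  rw [hpar, ← h]
  linarith

theorem quadForm_add (P Q : Matrix (Fin n) (Fin n) ℝ) (v : Fin n → ℝ) :
    quadForm (P + Q) v = quadForm P v + quadForm Q v := by
  simp [quadForm, Matrix.add_mulVec, dotProduct_add]

theorem quadForm_smul (c : ℝ) (P : Matrix (Fin n) (Fin n) ℝ) (v : Fin n → ℝ) :
    quadForm (c • P) v = c * quadForm P v := by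
  simp [quadForm, Matrix.smul_mulVec]

theorem quadForm_sum {ι : Type*} (s : Finset ι) (f : ι → Matrix (Fin n) (Fin n) ℝ)
    (v : Fin n → ℝ) : quadForm (∑ i ∈ s, f i) v = ∑ i ∈ s, quadForm (f i) v := by
  simp [quadForm, Matrix.sum_mulVec, dotProduct_sum]

@[fun_prop]
theorem continuous_quadForm {X : Type*} [TopologicalSpace X]
    {f : X → Matrix (Fin n) (Fin n) ℝ} {g : X → Fin n → ℝ} (hf : Continuous f)
    (hg : Continuous g) : Continuous fun x => quadForm (f x) (g x) := by
  unfold quadForm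
  fun_prop

/-- The matrices allowed in the sampled problem, whatever the samples. -/
def admissible (n : ℕ) (C : ℝ) : Set (Matrix (Fin n) (Fin n) ℝ) :=
  {P | P.IsSymm ∧ (P - 1).PosSemidef ∧ frobeniusNorm P ≤ C}

theorem posSemidef_iff_quadForm {P : Matrix (Fin n) (Fin n) ℝ} (hP : P.IsSymm) :
    P.PosSemidef ↔ ∀ v, 0 ≤ quadForm P v := by
  rw [Matrix.posSemidef_iff_dotProduct_mulVec]
  simp only [quadForm, star_trivial]
  exact and_iff_right (by rwa [Matrix.IsHermitian, Matrix.conjTranspose_eq_transpose_of_trivial])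

theorem admissible_eq (n : ℕ) (C : ℝ) : admissible n C =
    {P | P.transpose = P} ∩ ((⋂ v, {P | 0 ≤ quadForm (P - 1) v}) ∩ {P | frobeniusNorm P ≤ C}) := by
  ext P
  refine and_congr_right fun hP => ?_
  have hP1 : (P - 1).IsSymm := by
    rw [Matrix.IsSymm, Matrix.transpose_sub, hP.eq, Matrix.transpose_one]
  rw [posSemidef_iff_quadForm hP1]
  simp

theorem convex_admissible (C : ℝ) : Convex ℝ (admissible n C) := by
  rw [admissible_eq]
  refine Convex.inter ?_ (Convex.inter (convex_iInter fun v => ?_) (convex_frobeniusNorm_le C))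
  · intro P hP Q hQ a b _ _ _
    simp only [Set.mem_ofPred_eq] at *
    rw [Matrix.transpose_add, Matrix.transpose_smul, Matrix.transpose_smul, hP, hQ]
  · intro P hP Q hQ a b ha hb hab
    simp only [Set.mem_ofPred_eq, quadForm_sub, quadForm_add, quadForm_smul] at *
    have h1 := add_nonneg (mul_nonneg ha hP) (mul_nonneg hb hQ)
    have h2 : quadForm 1 v = (a + b) * quadForm 1 v := by rw [hab, one_mul]
    linarith

theorem isCompact_admissible (C : ℝ) : IsCompact (admissible n C) := by
  have hclosed : IsClosed (admissible n C) := by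
    rw [admissible_eq]
    refine IsClosed.inter (isClosed_eq (by fun_prop) continuous_id)
      (IsClosed.inter (isClosed_iInter fun v => isClosed_le continuous_const ?_)
        (isClosed_le (by fun_prop) continuous_const))
    exact continuous_quadForm (by fun_prop) continuous_const
  have hbox : IsCompact (Set.univ.pi fun _ : Fin n => Set.univ.pi fun _ : Fin n =>
      Set.Icc (-C) C) := isCompact_univ_pi fun _ => isCompact_univ_pi fun _ => isCompact_Icc
  refine hbox.of_isClosed_subset hclosed fun P hP i _ j _ => ?_
  change Matrix (Fin n) (Fin n) ℝ at P
  have hC : 0 ≤ C := (frobeniusNorm_nonneg P).trans hP.2.2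
  have h1 : P i j ^ 2 ≤ C ^ 2 := by
    refine le_trans ?_ (pow_le_pow_left₀ (frobeniusNorm_nonneg P) hP.2.2 2)
    rw [frobeniusNorm_sq]
    refine le_trans ?_ (Finset.single_le_sum (f := fun i => ∑ j, P i j ^ 2)
      (fun i _ => Finset.sum_nonneg fun j _ => sq_nonneg _) (Finset.mem_univ i))
    exact Finset.single_le_sum (f := fun j => P i j ^ 2) (fun j _ => sq_nonneg _)
      (Finset.mem_univ j)
  exact abs_le_of_sq_le_sq' h1 hC

theorem one_mem_admissible (hn : 0 < n) {C : ℝ} (hC : (n : ℝ) ≤ C) :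
    (1 : Matrix (Fin n) (Fin n) ℝ) ∈ admissible n C := by
  refine ⟨Matrix.transpose_one, by rw [sub_self]; exact Matrix.PosSemidef.zero, ?_⟩
  have h1 : frobeniusNorm (1 : Matrix (Fin n) (Fin n) ℝ) ^ 2 = n := by
    rw [frobeniusNorm_sq]
    simp [Matrix.one_apply]
  refine le_trans ?_ hC
  refine abs_le_of_sq_le_sq' (b := (n : ℝ)) ?_ (by positivity) |>.2
  rw [h1]
  have : (1 : ℝ) ≤ n := by exact_mod_cast hn
  nlinarith

theorem admissible_posDef {C : ℝ} {P : Matrix (Fin n) (Fin n) ℝ} (hP : P ∈ admissible n C) :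
    P.PosDef := posDef_of_one_le hP.2.1

end Feasible

/-! ### The sampled problem -/

section Problem

variable {n : ℕ} {𝒜 : Finset (Matrix (Fin n) (Fin n) ℝ)}

/-- The amount `(Ax)ᵀP(Ax) - γ² xᵀPx` by which the constraint of the sample `δ = (A, x)` is
exceeded. -/
def excess (δ : Sample 𝒜) (γ : ℝ) (P : Matrix (Fin n) (Fin n) ℝ) : ℝ :=
  quadForm P ((δ.1 : Matrix (Fin n) (Fin n) ℝ).mulVec δ.2.1.ofLp) -
    γ ^ 2 * quadForm P δ.2.1.ofLp

theorem isFeasible_iff {C : ℝ} {ω : Set (Sample 𝒜)} {s : ℝ × Matrix (Fin n) (Fin n) ℝ} :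
    IsFeasible C ω s ↔ 0 ≤ s.1 ∧ s.2 ∈ admissible n C ∧ ∀ δ ∈ ω, excess δ s.1 s.2 ≤ 0 := by
  simp only [excess, sub_nonpos]
  exact ⟨fun h => ⟨h.1, ⟨h.2, h.3, h.4⟩, h.5⟩,
    fun h => ⟨h.1, h.2.1.1, h.2.1.2.1, h.2.1.2.2, h.2.2⟩⟩

theorem excess_add (δ : Sample 𝒜) (γ : ℝ) (P Q : Matrix (Fin n) (Fin n) ℝ) :
    excess δ γ (P + Q) = excess δ γ P + excess δ γ Q := by
  simp only [excess, quadForm_add]; ring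

theorem excess_smul (δ : Sample 𝒜) (γ c : ℝ) (P : Matrix (Fin n) (Fin n) ℝ) :
    excess δ γ (c • P) = c * excess δ γ P := by
  simp only [excess, quadForm_smul]; ring

theorem excess_sum {ι : Type*} (δ : Sample 𝒜) (γ : ℝ) (s : Finset ι)
    (f : ι → Matrix (Fin n) (Fin n) ℝ) :
    excess δ γ (∑ i ∈ s, f i) = ∑ i ∈ s, excess δ γ (f i) := by
  simp only [excess, quadForm_sum, Finset.mul_sum, Finset.sum_sub_distrib]

theorem sphere_ofLp_ne_zero (x : Sphere n) : x.1.ofLp ≠ 0 := by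
  intro h
  have h1 : x.1 = 0 := by ext i; exact congrFun h i
  have h2 := norm_eq_of_mem_sphere x
  rw [h1, norm_zero] at h2
  exact zero_ne_one h2

theorem excess_lt {C : ℝ} {P : Matrix (Fin n) (Fin n) ℝ} (hP : P ∈ admissible n C)
    (δ : Sample 𝒜) {γ γ' : ℝ} (hγ : 0 ≤ γ) (hlt : γ < γ') : excess δ γ' P < excess δ γ P := by
  have h1 := quadForm_pos (admissible_posDef hP) (sphere_ofLp_ne_zero δ.2)
  have h2 : γ ^ 2 < γ' ^ 2 := pow_lt_pow_left₀ hlt hγ two_ne_zero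
  have := mul_lt_mul_of_pos_right h2 h1
  simp only [excess]
  linarith

theorem excess_anti {C : ℝ} {P : Matrix (Fin n) (Fin n) ℝ} (hP : P ∈ admissible n C)
    (δ : Sample 𝒜) {γ γ' : ℝ} (hγ : 0 ≤ γ) (hle : γ ≤ γ') : excess δ γ' P ≤ excess δ γ P := by
  rcases hle.eq_or_lt with rfl | hlt
  · exact le_rfl
  · exact (excess_lt hP δ hγ hlt).le

@[fun_prop]
theorem continuous_excess {X : Type*} [TopologicalSpace X] {d : X → Sample 𝒜} {g : X → ℝ}
    {f : X → Matrix (Fin n) (Fin n) ℝ} (hd : Continuous d) (hg : Continuous g)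
    (hf : Continuous f) : Continuous fun x => excess (d x) (g x) (f x) := by
  unfold excess
  have h1 : Continuous fun x => ((d x).1 : Matrix (Fin n) (Fin n) ℝ) :=
    continuous_subtype_val.comp (continuous_fst.comp hd)
  have h2 : Continuous fun x => (d x).2.1.ofLp :=
    (PiLp.continuous_ofLp 2 _).comp (continuous_subtype_val.comp (continuous_snd.comp hd))
  exact (continuous_quadForm hf (h1.matrix_mulVec h2)).sub
    ((hg.pow 2).mul (continuous_quadForm hf h2))

theorem cost_le_iff {s t : ℝ × Matrix (Fin n) (Fin n) ℝ} :
    cost s ≤ cost t ↔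
      s.1 < t.1 ∨ s.1 = t.1 ∧ frobeniusNorm s.2 ^ 2 ≤ frobeniusNorm t.2 ^ 2 :=
  Prod.Lex.le_iff

/-- An optimum exists by compactness: the identity is feasible for large `γ`, the least feasible
`γ` is attained, and then so is the least norm. -/
theorem exists_isOptimal (hn : 0 < n) {C : ℝ} (hC : (n : ℝ) ≤ C) {ω : Set (Sample 𝒜)}
    (hω : ω.Finite) : ∃ s, IsOptimal C ω s := by
  have hclosed : IsClosed {p : ℝ × Matrix (Fin n) (Fin n) ℝ | ∀ δ ∈ ω, excess δ p.1 p.2 ≤ 0} := by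
    simp only [Set.ofPred_forall]
    exact isClosed_iInter fun δ => isClosed_iInter fun _ =>
      isClosed_le (continuous_excess continuous_const continuous_fst continuous_snd)
        continuous_const
  obtain ⟨b, hb⟩ := (hω.image fun δ => quadForm 1
    ((δ.1 : Matrix (Fin n) (Fin n) ℝ).mulVec δ.2.1.ofLp)).bddAbove
  set γ₀ := max b 1
  have hγ₀ : 1 ≤ γ₀ := le_max_right _ _
  have hfeas₀ : ∀ δ ∈ ω, excess δ γ₀ 1 ≤ 0 := by
    intro δ hδ
    have h1 : quadForm 1 ((δ.1 : Matrix (Fin n) (Fin n) ℝ).mulVec δ.2.1.ofLp) ≤ γ₀ :=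
      (hb ⟨δ, hδ, rfl⟩).trans (le_max_left _ _)
    have h2 : quadForm 1 δ.2.1.ofLp = 1 := by
      rw [quadForm_one_ofLp, norm_eq_of_mem_sphere, one_pow]
    simp only [excess, h2]
    nlinarith
  have hcpt : IsCompact ((Set.Icc 0 γ₀ ×ˢ admissible n C) ∩
      {p : ℝ × Matrix (Fin n) (Fin n) ℝ | ∀ δ ∈ ω, excess δ p.1 p.2 ≤ 0}) :=
    (isCompact_Icc.prod (isCompact_admissible C)).inter_right hclosed
  obtain ⟨⟨γ, P₁⟩, ⟨⟨hγ, hP₁⟩, hex₁⟩, hmin⟩ := hcpt.exists_isMinOn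
    ⟨(γ₀, 1), ⟨⟨⟨by linarith, le_rfl⟩, one_mem_admissible hn hC⟩, hfeas₀⟩⟩
    continuous_fst.continuousOn
  have hcpt2 : IsCompact (admissible n C ∩
      {P : Matrix (Fin n) (Fin n) ℝ | ∀ δ ∈ ω, excess δ γ P ≤ 0}) :=
    (isCompact_admissible C).inter_right
      (hclosed.preimage (Continuous.prodMk continuous_const continuous_id))
  obtain ⟨P, ⟨hP, hex⟩, hminP⟩ := hcpt2.exists_isMinOn ⟨P₁, hP₁, hex₁⟩
    (continuous_frobeniusNorm.pow 2).continuousOn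
  refine ⟨(γ, P), isFeasible_iff.2 ⟨hγ.1, hP, hex⟩, fun t ht => ?_⟩
  rw [isFeasible_iff] at ht
  rw [cost_le_iff]
  have hle : γ ≤ t.1 := by
    rcases le_total t.1 γ₀ with h | h
    · exact hmin ⟨⟨⟨ht.1, h⟩, ht.2.1⟩, ht.2.2⟩
    · exact hγ.2.trans h
  rcases hle.lt_or_eq with h | h
  · exact Or.inl h
  · exact Or.inr ⟨h, hminP ⟨ht.2.1, fun δ hδ => by rw [h]; exact ht.2.2 δ hδ⟩⟩

/-- The midpoint of two optima is feasible, and of smaller norm if they differ. -/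
theorem isOptimal_unique {C : ℝ} {ω : Set (Sample 𝒜)} {s t : ℝ × Matrix (Fin n) (Fin n) ℝ}
    (hs : IsOptimal C ω s) (ht : IsOptimal C ω t) : s = t := by
  have hc : cost s = cost t := le_antisymm (hs.2 t ht.1) (ht.2 s hs.1)
  have hc' := Prod.ext_iff.1 (toLex.injective hc)
  obtain ⟨hγ, hF⟩ : s.1 = t.1 ∧ frobeniusNorm s.2 ^ 2 = frobeniusNorm t.2 ^ 2 := hc'
  by_contra hne
  have hP : s.2 ≠ t.2 := fun h => hne (Prod.ext hγ h)
  have hfs := isFeasible_iff.1 hs.1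
  have hft := isFeasible_iff.1 ht.1
  have hmid : IsFeasible C ω (s.1, (1 / 2 : ℝ) • s.2 + (1 / 2 : ℝ) • t.2) := by
    refine isFeasible_iff.2 ⟨hfs.1, convex_admissible C hfs.2.1 hft.2.1 (by norm_num)
      (by norm_num) (by norm_num), fun δ hδ => ?_⟩
    have h1 := hfs.2.2 δ hδ
    have h2 := hft.2.2 δ hδ
    rw [← hγ] at h2
    rw [excess_add, excess_smul, excess_smul]
    linarith
  rcases cost_le_iff.1 (hs.2 _ hmid) with h | ⟨-, h⟩
  · exact lt_irrefl _ h
  · exact absurd (frobeniusNorm_midpoint_lt hP hF) (not_lt.2 h)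

/-- At a positive optimal `γ` no admissible matrix satisfies all constraints strictly, as `γ` could
then be decreased. -/
theorem IsOptimal.not_strict {C : ℝ} {ω : Set (Sample 𝒜)} (hω : ω.Finite)
    {s : ℝ × Matrix (Fin n) (Fin n) ℝ} (hs : IsOptimal C ω s) (hpos : 0 < s.1)
    {Q : Matrix (Fin n) (Fin n) ℝ} (hQ : Q ∈ admissible n C) :
    ¬ ∀ δ ∈ ω, excess δ s.1 Q < 0 := by
  intro hlt
  have hev : ∀ᶠ γ in nhdsWithin s.1 (Set.Iio s.1), ∀ δ ∈ ω, excess δ γ Q < 0 := by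
    refine (hω.eventually_all).2 fun δ hδ => ?_
    have hc : Continuous fun γ => excess δ γ Q :=
      continuous_excess continuous_const continuous_id continuous_const
    exact nhdsWithin_le_nhds (hc.continuousAt.eventually_lt_const (hlt δ hδ))
  obtain ⟨γ, hγ, hγpos⟩ := (hev.and (Ioo_mem_nhdsLT hpos)).exists
  have := hs.2 (γ, Q) (isFeasible_iff.2 ⟨hγpos.1.le, hQ, fun δ hδ => (hγ δ hδ).le⟩)
  rcases cost_le_iff.1 this with h | ⟨h, -⟩
  · exact lt_asymm h hγpos.2
  · exact hγpos.2.ne h.symm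

/-- If removing constraints changes the optimum, it decreases the cost. -/
theorem cost_lt_of_ne {C : ℝ} {ω ω' : Set (Sample 𝒜)} (hsub : ω' ⊆ ω)
    {s s' : ℝ × Matrix (Fin n) (Fin n) ℝ} (hs : IsOptimal C ω s) (hs' : IsOptimal C ω' s')
    (hne : s' ≠ s) :
    s'.1 < s.1 ∨ s'.1 = s.1 ∧ frobeniusNorm s'.2 < frobeniusNorm s.2 := by
  have hfeas : IsFeasible C ω' s :=
    ⟨hs.1.1, hs.1.2, hs.1.3, hs.1.4, fun δ hδ => hs.1.5 δ (hsub hδ)⟩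
  rcases cost_le_iff.1 (hs'.2 s hfeas) with h | ⟨h1, h2⟩
  · exact Or.inl h
  · refine Or.inr ⟨h1, lt_of_le_of_ne ?_ fun h => ?_⟩
    · exact (sq_le_sq₀ (frobeniusNorm_nonneg _) (frobeniusNorm_nonneg _)).1 h2
    · refine hne (isOptimal_unique hs' ⟨hfeas, fun t ht => ?_⟩)
      refine le_trans ?_ (hs'.2 t ht)
      exact cost_le_iff.2 (Or.inr ⟨h1.symm, by rw [h]⟩)

/-- A constraint that is not tight at the optimum may be dropped: the sampled problem is convex
for fixed `γ`, so that a better solution of the problem without this constraint could be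
approached from the optimum while keeping the constraint. -/
theorem isOptimal_sdiff_of_not_tight {C : ℝ} {ω : Set (Sample 𝒜)} (hω : ω.Finite) {δ : Sample 𝒜}
    {s s' : ℝ × Matrix (Fin n) (Fin n) ℝ} (hs : IsOptimal C ω s)
    (hs' : IsOptimal C (ω \ {δ}) s') (hδ : excess δ s.1 s.2 < 0) : s' = s := by
  by_contra hne
  have hfs := isFeasible_iff.1 hs.1
  have hfs' := isFeasible_iff.1 hs'.1
  have hc : Continuous fun t : ℝ => excess δ s.1 ((1 - t) • s.2 + t • s'.2) :=
    continuous_excess continuous_const continuous_const (by fun_prop)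
  have hev : ∀ᶠ t in nhdsWithin (0 : ℝ) (Set.Ioi 0),
      excess δ s.1 ((1 - t) • s.2 + t • s'.2) < 0 :=
    nhdsWithin_le_nhds (hc.continuousAt.eventually_lt_const (by simpa using hδ))
  obtain ⟨t, ht, ht0, ht1⟩ := (hev.and (Ioo_mem_nhdsGT (zero_lt_one' ℝ))).exists
  have hadm : (1 - t) • s.2 + t • s'.2 ∈ admissible n C :=
    convex_admissible C hfs.2.1 hfs'.2.1 (by linarith) ht0.le (by ring)
  rcases cost_lt_of_ne Set.sdiff_subset hs hs' hne with h | ⟨h, hF⟩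
  · refine hs.not_strict hω (hfs'.1.trans_lt h) hadm fun δ' hδ' => ?_
    by_cases hdd : δ' = δ
    · rwa [hdd]
    · have h1 := hfs.2.2 δ' hδ'
      have h2 := (excess_lt hfs'.2.1 δ' hfs'.1 h).trans_le (hfs'.2.2 δ' ⟨hδ', hdd⟩)
      rw [excess_add, excess_smul, excess_smul]
      nlinarith
  · have hfeas : IsFeasible C ω (s.1, (1 - t) • s.2 + t • s'.2) := by
      refine isFeasible_iff.2 ⟨hfs.1, hadm, fun δ' hδ' => ?_⟩
      by_cases hdd : δ' = δ
      · rw [hdd]; exact ht.le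
      · have h1 := hfs.2.2 δ' hδ'
        have h2 := hfs'.2.2 δ' ⟨hδ', hdd⟩
        rw [h] at h2
        simp only
        rw [excess_add, excess_smul, excess_smul]
        nlinarith
    have hlt := frobeniusNorm_convexComb_lt hF ht0 ht1.le
    rcases cost_le_iff.1 (hs.2 _ hfeas) with h' | ⟨-, h'⟩
    · exact lt_irrefl _ h'
    · exact absurd (pow_lt_pow_left₀ hlt (frobeniusNorm_nonneg _) two_ne_zero) (not_lt.2 h')

end Problem

/-! ### The number of irredundant constraints -/

section Dimension

variable {n : ℕ} {𝒜 : Finset (Matrix (Fin n) (Fin n) ℝ)}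

/-- More than `n (n + 1) / 2` symmetric matrices are linearly dependent. -/
theorem exists_relation_of_isSymm {ι : Type*} [Fintype ι]
    (hι : n * (n + 1) / 2 < Fintype.card ι) {P : ι → Matrix (Fin n) (Fin n) ℝ}
    (hP : ∀ i, (P i).IsSymm) : ∃ g : ι → ℝ, ∑ i, g i • P i = 0 ∧ ∃ i, g i ≠ 0 := by
  let v : ι → Sym2 (Fin n) → ℝ := fun k =>
    Sym2.lift ⟨fun i j => P k i j, fun i j => ((hP k).apply i j).symm⟩
  have hv : ¬ LinearIndependent ℝ v := by
    intro h
    have := h.fintype_card_le_finrank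
    rw [Module.finrank_fintype_fun_eq_card, Sym2.card, Fintype.card_fin,
      Nat.choose_two_right, Nat.add_sub_cancel, mul_comm] at this
    omega
  obtain ⟨g, hg, hne⟩ := Fintype.not_linearIndependent_iff.1 hv
  refine ⟨g, ?_, hne⟩
  ext i j
  have := congrFun hg s(i, j)
  simpa [v, Matrix.sum_apply] using this

/-- In a nonnegative combination of the optima `s δ` of the problems without `δ`, every term with
`δ ≠ δ'` meets the constraint of `δ'`, so that the whole does if the coefficient of `s δ'`
vanishes. -/
theorem excess_posPart_combination_le {ω : Set (Sample 𝒜)} {C γ : ℝ}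
    {s : ω → ℝ × Matrix (Fin n) (Fin n) ℝ}
    (hs : ∀ δ : ω, IsFeasible C (ω \ {δ.1}) (s δ)) (hγ : ∀ δ, (s δ).1 ≤ γ) (δ' : ω)
    {c : ω → ℝ} (hc : ∀ δ, 0 ≤ c δ) (hc' : c δ' = 0) (δ : ω) :
    c δ * excess δ'.1 γ (s δ).2 ≤ 0 := by
  by_cases h : δ = δ'
  · rw [h, hc', zero_mul]
  · have hf := isFeasible_iff.1 (hs δ)
    refine mul_nonpos_of_nonneg_of_nonpos (hc δ) ?_
    refine (excess_anti hf.2.1 _ hf.1 (hγ δ)).trans (hf.2.2 _ ⟨δ'.2, ?_⟩)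
    exact fun h' => h (Subtype.ext h'.symm)

theorem sum_posPart_eq {ι : Type*} [Fintype ι] {P : ι → Matrix (Fin n) (Fin n) ℝ} {g : ι → ℝ}
    (hg : ∑ i, g i • P i = 0) : ∑ i, max (g i) 0 • P i = ∑ i, max (-g i) 0 • P i := by
  rw [← sub_eq_zero, ← Finset.sum_sub_distrib, ← hg]
  refine Finset.sum_congr rfl fun i _ => ?_
  rw [← sub_smul]
  congr 1
  rcases le_total (g i) 0 with h | h
  · rw [max_eq_right h, max_eq_left (by linarith)]; ring
  · rw [max_eq_left h, max_eq_right (by linarith)]; ring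

/-- The coefficients of a relation between positive definite matrices cannot all be nonpositive. -/
theorem exists_pos_of_relation (hn : 0 < n) {ι : Type*} [Fintype ι] {C : ℝ}
    {P : ι → Matrix (Fin n) (Fin n) ℝ} (hP : ∀ i, P i ∈ admissible n C) {g : ι → ℝ}
    (hg : ∑ i, g i • P i = 0) (hne : ∃ i, g i ≠ 0) : ∃ i, 0 < g i := by
  by_contra hall
  push Not at hall
  obtain ⟨i, hi⟩ := hne
  have hv : (fun _ : Fin n => (1 : ℝ)) ≠ 0 := fun h => one_ne_zero (congrFun h ⟨0, hn⟩)
  have h1 := congrArg (fun M => quadForm M fun _ => 1) hg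
  simp only [quadForm_sum, quadForm_smul] at h1
  have h2 : ∑ i, g i * quadForm (P i) (fun _ => 1) < 0 :=
    Finset.sum_neg' (fun j _ => mul_nonpos_of_nonpos_of_nonneg (hall j)
      (quadForm_pos (admissible_posDef (hP j)) hv).le)
      ⟨i, Finset.mem_univ i, mul_neg_of_neg_of_pos (lt_of_le_of_ne (hall i) hi)
        (quadForm_pos (admissible_posDef (hP i)) hv)⟩
  rw [h1] at h2
  simp [quadForm] at h2

/-- Normalizing the combination of the `Pᵢ` with positive coefficients. -/
theorem normalized_mem {ι : Type*} [Fintype ι] {S : Set (Matrix (Fin n) (Fin n) ℝ)}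
    (hS : Convex ℝ S) {P : ι → Matrix (Fin n) (Fin n) ℝ} {g : ι → ℝ}
    (hP : ∀ i, 0 < g i → P i ∈ S) (hpos : ∃ i, 0 < g i) :
    ∃ a : ℝ, 0 < a ∧ a • ∑ i, max (g i) 0 • P i ∈ S := by
  have hsum : 0 < ∑ i, max (g i) 0 := by
    obtain ⟨i, hi⟩ := hpos
    exact Finset.sum_pos' (fun j _ => le_max_right _ _)
      ⟨i, Finset.mem_univ i, lt_max_of_lt_left hi⟩
  have hfil : ∑ i, max (g i) 0 • P i = ∑ i with 0 < g i, max (g i) 0 • P i := by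
    refine (Finset.sum_filter_of_ne fun i _ h => ?_).symm
    by_contra hi
    exact h (by rw [max_eq_right (not_lt.1 hi), zero_smul])
  have hfil' : ∑ i, max (g i) 0 = ∑ i with 0 < g i, max (g i) 0 := by
    refine (Finset.sum_filter_of_ne fun i _ h => ?_).symm
    by_contra hi
    exact h (max_eq_right (not_lt.1 hi))
  refine ⟨(∑ i, max (g i) 0)⁻¹, inv_pos.2 hsum, ?_⟩
  rw [hfil'] at hsum
  rw [hfil, hfil']
  have := hS.centerMass_mem (t := Finset.univ.filter fun i => 0 < g i)
    (w := fun i => max (g i) 0) (z := P) (fun i _ => le_max_right _ _) hsum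
    (fun i hi => hP i (Finset.mem_filter.1 hi).2)
  exact this

/-- A linear relation `∑ gᵢ Pᵢ = 0` between the optima `(γᵢ, Pᵢ)` of the problems with one
constraint removed forces `γᵢ < γ` for some `i` with `gᵢ > 0`. Otherwise a convex combination of
the `Pᵢ` with `gᵢ > 0`, all of norm smaller than that of the optimum `P`, would be feasible: it
satisfies the constraints with `gᵢ ≤ 0`, and by homogeneity also the others, being proportional to
a combination of the `Pⱼ` with `gⱼ < 0`. -/
theorem exists_gamma_lt_of_relation {C : ℝ} {ω : Set (Sample 𝒜)} [Fintype ω]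
    {s₀ : ℝ × Matrix (Fin n) (Fin n) ℝ} (hs₀ : IsOptimal C ω s₀)
    {s : ω → ℝ × Matrix (Fin n) (Fin n) ℝ} (hs : ∀ δ : ω, IsOptimal C (ω \ {δ.1}) (s δ))
    (hne : ∀ δ, s δ ≠ s₀) {g : ω → ℝ} (hg : ∑ δ, g δ • (s δ).2 = 0) (hpos : ∃ δ, 0 < g δ) :
    ∃ δ, 0 < g δ ∧ (s δ).1 < s₀.1 := by
  by_contra hall
  push Not at hall
  have hlt := fun δ => cost_lt_of_ne Set.sdiff_subset hs₀ (hs δ) (hne δ)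
  have hγ : ∀ δ, (s δ).1 ≤ s₀.1 := fun δ => (hlt δ).elim le_of_lt fun h => h.1.le
  obtain ⟨a, ha, hmem⟩ := normalized_mem ((convex_admissible C).inter
    (convex_frobeniusNorm_lt (frobeniusNorm s₀.2))) (P := fun δ => (s δ).2) (g := g)
    (fun δ hδ => ⟨(isFeasible_iff.1 (hs δ).1).2.1,
      (hlt δ).elim (fun h => absurd h (not_lt.2 (hall δ hδ))) fun h => h.2⟩) hpos
  have hfeas : IsFeasible C ω (s₀.1, a • ∑ δ, max (g δ) 0 • (s δ).2) := by
    refine isFeasible_iff.2 ⟨hs₀.1.1, hmem.1, fun δ' hδ' => ?_⟩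
    simp only
    rw [excess_smul]
    refine mul_nonpos_of_nonneg_of_nonpos ha.le ?_
    rcases le_total (g ⟨δ', hδ'⟩) 0 with h | h
    · rw [excess_sum]
      simp only [excess_smul]
      exact Finset.sum_nonpos fun δ _ => excess_posPart_combination_le (fun δ => (hs δ).1) hγ
        ⟨δ', hδ'⟩ (c := fun δ => max (g δ) 0) (fun _ => le_max_right _ _) (max_eq_right h) δ
    · rw [sum_posPart_eq hg, excess_sum]
      simp only [excess_smul]
      exact Finset.sum_nonpos fun δ _ => excess_posPart_combination_le (fun δ => (hs δ).1) hγ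
        ⟨δ', hδ'⟩ (c := fun δ => max (-g δ) 0) (fun _ => le_max_right _ _)
        (max_eq_right (by linarith)) δ
  rcases cost_le_iff.1 (hs₀.2 _ hfeas) with h | ⟨-, h⟩
  · exact lt_irrefl _ h
  · exact absurd (pow_lt_pow_left₀ hmem.2 (frobeniusNorm_nonneg _) two_ne_zero) (not_lt.2 h)

/-- If no constraint of a finite problem can be dropped without changing the optimum, there are at
most `n (n + 1) / 2` constraints. Otherwise the optima `(γᵢ, Pᵢ)` of the problems with one
constraint removed satisfy a relation `∑ gᵢ Pᵢ = 0`. By `exists_gamma_lt_of_relation`, applied to `g` and `-g`,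
some `γᵢ < γ` with `gᵢ > 0` and some `γⱼ < γ` with `gⱼ < 0`, and the combination of the `Pᵢ` with
`gᵢ > 0` then satisfies all constraints strictly, contradicting the optimality of `γ`. -/
theorem ncard_le_of_irredundant (hn : 0 < n) {C : ℝ} {ω : Set (Sample 𝒜)} (hω : ω.Finite)
    {s₀ : ℝ × Matrix (Fin n) (Fin n) ℝ} (hs₀ : IsOptimal C ω s₀)
    {s : ω → ℝ × Matrix (Fin n) (Fin n) ℝ} (hs : ∀ δ : ω, IsOptimal C (ω \ {δ.1}) (s δ))
    (hne : ∀ δ, s δ ≠ s₀) : ω.ncard ≤ n * (n + 1) / 2 := by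
  have := hω.fintype
  by_contra hcard
  rw [not_le, ← Set.fintypeCard_eq_ncard] at hcard
  have hadm : ∀ δ, (s δ).2 ∈ admissible n C := fun δ => (isFeasible_iff.1 (hs δ).1).2.1
  obtain ⟨g, hg, hgne⟩ := exists_relation_of_isSymm hcard fun δ => (hadm δ).1
  have hg' : ∑ δ, (-g δ) • (s δ).2 = 0 := by
    simp only [neg_smul, Finset.sum_neg_distrib, hg, neg_zero]
  have hpos := exists_pos_of_relation hn hadm hg hgne
  have hpos' := exists_pos_of_relation hn hadm hg' (by simpa using hgne)
  obtain ⟨δ₁, h1, hγ1⟩ := exists_gamma_lt_of_relation hs₀ hs hne hg hpos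
  obtain ⟨δ₂, h2, hγ2⟩ := exists_gamma_lt_of_relation hs₀ hs hne hg' hpos'
  have hγ : ∀ δ, (s δ).1 ≤ s₀.1 := fun δ =>
    (cost_lt_of_ne Set.sdiff_subset hs₀ (hs δ) (hne δ)).elim le_of_lt fun h => h.1.le
  have hstrict : ∀ δ δ' : ω, δ ≠ δ' → (s δ).1 < s₀.1 → excess δ'.1 s₀.1 (s δ).2 < 0 := by
    intro δ δ' hδ hlt
    have hf := isFeasible_iff.1 (hs δ).1
    exact (excess_lt hf.2.1 _ hf.1 hlt).trans_le
      (hf.2.2 _ ⟨δ'.2, fun h' => hδ (Subtype.ext h'.symm)⟩)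
  obtain ⟨a, ha, hmem⟩ := normalized_mem (convex_admissible C) (fun δ _ => hadm δ) hpos
  refine hs₀.not_strict hω ((isFeasible_iff.1 (hs δ₁).1).1.trans_lt hγ1) hmem fun δ' hδ' => ?_
  rw [excess_smul]
  refine mul_neg_of_pos_of_neg ha ?_
  -- A constraint with nonpositive coefficient is strict thanks to `δ₁`, the others thanks to `δ₂`.
  rcases le_or_gt (g ⟨δ', hδ'⟩) 0 with h | h
  · rw [excess_sum]
    simp only [excess_smul]
    refine Finset.sum_neg' (fun δ _ => excess_posPart_combination_le (fun δ => (hs δ).1) hγ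
      ⟨δ', hδ'⟩ (c := fun δ => max (g δ) 0) (fun _ => le_max_right _ _) (max_eq_right h) δ)
      ⟨δ₁, Finset.mem_univ _, mul_neg_of_pos_of_neg (lt_max_of_lt_left h1)
        (hstrict δ₁ ⟨δ', hδ'⟩ ?_ hγ1)⟩
    rintro rfl
    exact absurd h1 (not_lt.2 h)
  · rw [sum_posPart_eq hg, excess_sum]
    simp only [excess_smul]
    refine Finset.sum_neg' (fun δ _ => excess_posPart_combination_le (fun δ => (hs δ).1) hγ
      ⟨δ', hδ'⟩ (c := fun δ => max (-g δ) 0) (fun _ => le_max_right _ _)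
      (max_eq_right (by linarith)) δ)
      ⟨δ₂, Finset.mem_univ _, mul_neg_of_pos_of_neg (lt_max_of_lt_left h2)
        (hstrict δ₂ ⟨δ', hδ'⟩ ?_ hγ2)⟩
    rintro rfl
    linarith

end Dimension

/-! ### Null sets of tight samples -/

section Tight

variable {n : ℕ}

theorem exists_quadForm_ne_zero {M : Matrix (Fin n) (Fin n) ℝ} (hM : M.IsSymm) (h0 : M ≠ 0) :
    ∃ v, quadForm M v ≠ 0 := by
  by_contra hall
  push Not at hall
  apply h0
  have key : ∀ v w : Fin n → ℝ, v ⬝ᵥ M.mulVec w = 0 := by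
    intro v w
    have h1 := hall (v + w)
    have h2 := hall v
    have h3 := hall w
    have hsymm : w ⬝ᵥ M.mulVec v = v ⬝ᵥ M.mulVec w := by
      rw [Matrix.dotProduct_mulVec, ← Matrix.mulVec_transpose, hM.eq, dotProduct_comm]
    simp only [quadForm, Matrix.mulVec_add, dotProduct_add, add_dotProduct] at h1 h2 h3
    linarith
  ext i j
  have := key (Pi.single i 1) (Pi.single j 1)
  simpa using this

/-- The zero set of a nonzero quadratic form has measure zero, as it meets the lines of some
direction in at most two points. -/
theorem volume_quadForm_eq_zero {M : Matrix (Fin n) (Fin n) ℝ} (hM : M.IsSymm) (h0 : M ≠ 0) :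
    volume {z : EuclideanSpace ℝ (Fin n) | quadForm M z.ofLp = 0} = 0 := by
  obtain ⟨v, hv⟩ := exists_quadForm_ne_zero hM h0
  have hmeas : MeasurableSet {z : EuclideanSpace ℝ (Fin n) | quadForm M z.ofLp ≠ 0} :=
    (isOpen_ne_fun (continuous_quadForm continuous_const (PiLp.continuous_ofLp 2 _))
      continuous_const).measurableSet
  have hae := ae_mem_of_ae_add_linearMap_mem
    (LinearMap.toSpanSingleton ℝ (EuclideanSpace ℝ (Fin n)) (WithLp.toLp 2 v))
    (volume : Measure ℝ) (volume : Measure (EuclideanSpace ℝ (Fin n))) hmeas fun y => by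
      set p : Polynomial ℝ := Polynomial.C (quadForm M v) * Polynomial.X ^ 2 +
        Polynomial.C (y.ofLp ⬝ᵥ M.mulVec v + v ⬝ᵥ M.mulVec y.ofLp) * Polynomial.X +
        Polynomial.C (quadForm M y.ofLp) with hp
      have hp0 : p ≠ 0 := by
        intro h
        have := congrArg (fun q => Polynomial.coeff q 2) h
        simp [hp] at this
        exact hv this
      have hfin : {t : ℝ | p.eval t = 0}.Finite := by
        refine (p.roots.toFinset.finite_toSet).subset fun t ht => ?_
        simpa [hp0] using ht
      have hnull : ∀ᵐ t : ℝ, ¬ p.eval t = 0 := by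
        rw [ae_iff]
        simpa using hfin.measure_zero volume
      filter_upwards [hnull] with t ht
      refine fun hz => ht ?_
      rw [← hz]
      simp only [hp, Polynomial.eval_add, Polynomial.eval_mul, Polynomial.eval_C,
        Polynomial.eval_pow, Polynomial.eval_X, LinearMap.toSpanSingleton_apply, quadForm,
        WithLp.ofLp_add, WithLp.ofLp_smul, Matrix.mulVec_add, dotProduct_add, add_dotProduct,
        Matrix.mulVec_smul, smul_dotProduct, dotProduct_smul, smul_eq_mul]
      ring
  rw [ae_iff] at hae
  simpa using hae

instance isProbabilityMeasure_sphereUniform [NeZero n] :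
    IsProbabilityMeasure (sphereUniform n) := by
  have : Nonempty (Fin n) := ⟨0⟩
  refine ⟨?_⟩
  rw [sphereUniform, Measure.smul_apply, smul_eq_mul]
  refine ENNReal.inv_mul_cancel ?_ (measure_ne_top _ _)
  rw [Ne, Measure.measure_univ_eq_zero]
  exact Measure.toSphere_ne_zero _

theorem sphereUniform_quadForm_eq_zero [NeZero n] {M : Matrix (Fin n) (Fin n) ℝ} (hM : M.IsSymm)
    (h0 : M ≠ 0) : sphereUniform n {x : Sphere n | quadForm M x.1.ofLp = 0} = 0 := by
  have hn : 0 < n := Nat.pos_of_ne_zero (NeZero.ne n)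
  set E : Set (EuclideanSpace ℝ (Fin n)) := {z | quadForm M z.ofLp = 0} \ {0}
  have hmeas : MeasurableSet E :=
    ((isClosed_eq (continuous_quadForm continuous_const (PiLp.continuous_ofLp 2 _))
      continuous_const).measurableSet).diff (measurableSet_singleton 0)
  have hcone : ∀ c : ℝ, 0 < c → ∀ z, c • z ∈ E ↔ z ∈ E := by
    intro c hc z
    simp [E, quadForm_smul_vec, hc.ne']
  have h := sphereUniform_cone hn hmeas (by simp [E]) hcone
  have hE : volume.real (E ∩ Metric.ball 0 1) = 0 := by
    rw [measureReal_def, measure_mono_null (fun z hz => hz.1.1) (volume_quadForm_eq_zero hM h0),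
      ENNReal.toReal_zero]
  rw [hE, zero_div, measureReal_eq_zero_iff] at h
  refine measure_mono_null (fun x hx => ?_) h
  exact ⟨hx, fun h0 => sphere_ofLp_ne_zero x (by
    rw [Set.mem_singleton_iff] at h0
    rw [h0]
    rfl)⟩

variable {𝒜 : Finset (Matrix (Fin n) (Fin n) ℝ)}

theorem isProbabilityMeasure_sampleMeasure [NeZero n] (h𝒜 : 𝒜.Nonempty) :
    IsProbabilityMeasure (sampleMeasure 𝒜) := by
  have : Nonempty 𝒜 := h𝒜.to_subtype
  have := ProbabilityTheory.isProbabilityMeasure_uniformOn (Ω := 𝒜) Set.finite_univ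
    Set.univ_nonempty
  rw [sampleMeasure]
  infer_instance

theorem excess_eq_quadForm (A : 𝒜) (x : Sphere n) (γ : ℝ) (P : Matrix (Fin n) (Fin n) ℝ) :
    excess (A, x) γ P = quadForm ((A : Matrix (Fin n) (Fin n) ℝ).transpose * P * A.1 -
      γ ^ 2 • P) x.1.ofLp := by
  rw [excess, quadForm_sub, quadForm_smul]
  congr 1
  simp only [quadForm]
  rw [← Matrix.mulVec_mulVec, ← Matrix.mulVec_mulVec, Matrix.dotProduct_mulVec x.1.ofLp,
    Matrix.vecMul_transpose]

instance : OpensMeasurableSpace 𝒜 := ⟨le_top⟩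

/-- Almost no sample is tight for given `(γ, P)`, since `AᵀPA = γ²P` for no mode `A`. -/
theorem sampleMeasure_tight [NeZero n] (hBar : ∀ A ∈ 𝒜, ¬ IsBarabanov A) {γ : ℝ} (hγ : 0 ≤ γ)
    {P : Matrix (Fin n) (Fin n) ℝ} (hP : P.PosDef) :
    sampleMeasure 𝒜 {δ | excess δ γ P = 0} = 0 := by
  have hmeas : MeasurableSet {δ : Sample 𝒜 | excess δ γ P = 0} :=
    (isClosed_eq (continuous_excess continuous_id continuous_const continuous_const)
      continuous_const).measurableSet
  rw [sampleMeasure, Measure.measure_prod_null hmeas]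
  refine Eventually.of_forall fun A => ?_
  have hsymm : P.IsSymm := by
    have := hP.1
    rwa [Matrix.IsHermitian, Matrix.conjTranspose_eq_transpose_of_trivial] at this
  have hset : Prod.mk A ⁻¹' {δ : Sample 𝒜 | excess δ γ P = 0} = {x : Sphere n |
      quadForm ((A : Matrix (Fin n) (Fin n) ℝ).transpose * P * A.1 - γ ^ 2 • P) x.1.ofLp = 0} := by
    ext x
    simp only [Set.mem_preimage, Set.mem_ofPred_eq, excess_eq_quadForm]
  simp only [Pi.zero_apply]
  rw [hset]
  refine sphereUniform_quadForm_eq_zero ?_ fun h => hBar A A.2 ⟨P, hP, γ, hγ, sub_eq_zero.1 h⟩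
  rw [Matrix.IsSymm, Matrix.transpose_sub, Matrix.transpose_smul, Matrix.transpose_mul,
    Matrix.transpose_mul, Matrix.transpose_transpose, hsymm.eq, Matrix.mul_assoc]

end Tight

/-! ### Measurability of the optimum -/

section Measurability

variable {n : ℕ} {𝒜 : Finset (Matrix (Fin n) (Fin n) ℝ)}

instance : MeasurableSpace (Matrix (Fin n) (Fin n) ℝ) :=
  inferInstanceAs (MeasurableSpace (Fin n → Fin n → ℝ))

instance : BorelSpace (Matrix (Fin n) (Fin n) ℝ) :=
  inferInstanceAs (BorelSpace (Fin n → Fin n → ℝ))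

instance : SecondCountableTopology (Matrix (Fin n) (Fin n) ℝ) :=
  inferInstanceAs (SecondCountableTopology (Fin n → Fin n → ℝ))

/-- The projection of a closed set along a compact one is closed. -/
theorem isClosed_exists_mem_compact {X Y : Type*} [TopologicalSpace X] [TopologicalSpace Y]
    {K : Set Y} (hK : IsCompact K) {Z : Set (X × Y)} (hZ : IsClosed Z) :
    IsClosed {x | ∃ y ∈ K, (x, y) ∈ Z} := by
  have := isCompact_iff_compactSpace.1 hK
  have h := isClosedMap_fst_of_compactSpace (X := X) (Y := K) _
    (hZ.preimage (f := fun p : X × K => (p.1, (p.2 : Y))) (by fun_prop))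
  convert h using 1
  ext x
  constructor
  · rintro ⟨y, hy, hxy⟩
    exact ⟨(x, ⟨y, hy⟩), hxy, rfl⟩
  · rintro ⟨⟨x', y⟩, hxy, rfl⟩
    exact ⟨y, y.2, hxy⟩

/-- The optimum of the sampled problem (an arbitrary value if there is none). -/
noncomputable def optimum (C : ℝ) (ω : Set (Sample 𝒜)) : ℝ × Matrix (Fin n) (Fin n) ℝ :=
  Classical.epsilon (IsOptimal C ω)

variable {C : ℝ}

theorem isOptimal_optimum (hn : 0 < n) (hC : (n : ℝ) ≤ C) {ω : Set (Sample 𝒜)}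
    (hω : ω.Finite) : IsOptimal C ω (optimum C ω) :=
  Classical.epsilon_spec (exists_isOptimal hn hC hω)

theorem isClosed_excess_family (k : ℕ) : IsClosed {p : ((Fin k → Sample 𝒜) × ℝ) ×
    Matrix (Fin n) (Fin n) ℝ | ∀ i, excess (p.1.1 i) p.1.2 p.2 ≤ 0} := by
  simp only [Set.ofPred_forall]
  exact isClosed_iInter fun i => isClosed_le (continuous_excess
    ((continuous_apply i).comp (continuous_fst.comp continuous_fst))
    (continuous_snd.comp continuous_fst) continuous_snd) continuous_const

/-- The optimal `γ` is at most `c` on a closed set of samples. -/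
theorem measurable_optimum_fst (hn : 0 < n) (hC : (n : ℝ) ≤ C) (k : ℕ) :
    Measurable fun ω : Fin k → Sample 𝒜 => (optimum C (Set.range ω)).1 := by
  refine measurable_of_Iic fun c => ?_
  rcases lt_or_ge c 0 with hc | hc
  · convert MeasurableSet.empty
    ext ω
    have := (isOptimal_optimum hn hC (Set.finite_range ω)).1.1
    simp only [Set.mem_preimage, Set.mem_Iic, Set.mem_empty_iff_false, iff_false, not_le]
    linarith
  · have hcl := (isClosed_exists_mem_compact (isCompact_admissible C)
      (isClosed_excess_family (𝒜 := 𝒜) k)).preimage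
      (f := fun ω : Fin k → Sample 𝒜 => (ω, c)) (by fun_prop)
    convert hcl.measurableSet using 1
    ext ω
    have hopt := isOptimal_optimum hn hC (Set.finite_range ω)
    have hfeas := isFeasible_iff.1 hopt.1
    constructor
    · intro h
      exact ⟨_, hfeas.2.1, fun i =>
        (excess_anti hfeas.2.1 _ hfeas.1 h).trans (hfeas.2.2 _ ⟨i, rfl⟩)⟩
    · rintro ⟨P, hP, hex⟩
      have := hopt.2 (c, P) (isFeasible_iff.2 ⟨hc, hP, by rintro _ ⟨i, rfl⟩; exact hex i⟩)
      rcases cost_le_iff.1 this with h | h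
      · exact h.le
      · exact h.1.le

/-- The optimal norm is at most a given value if the samples and the optimal `γ`, which depends
measurably on them, lie in a closed set. -/
theorem measurable_frobeniusNorm_optimum (hn : 0 < n) (hC : (n : ℝ) ≤ C) (k : ℕ) :
    Measurable fun ω : Fin k → Sample 𝒜 => frobeniusNorm (optimum C (Set.range ω)).2 ^ 2 := by
  refine measurable_of_Iic fun c => ?_
  have hK : IsCompact (admissible n C ∩ {P | frobeniusNorm P ^ 2 ≤ c}) :=
    (isCompact_admissible C).inter_right
      (isClosed_le (continuous_frobeniusNorm.pow 2) continuous_const)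
  have hcl := (isClosed_exists_mem_compact hK (isClosed_excess_family (𝒜 := 𝒜) k)).measurableSet
  have hm : Measurable fun ω : Fin k → Sample 𝒜 => (ω, (optimum C (Set.range ω)).1) :=
    measurable_id.prodMk (measurable_optimum_fst hn hC k)
  convert hm hcl using 1
  ext ω
  have hopt := isOptimal_optimum hn hC (Set.finite_range ω)
  have hfeas := isFeasible_iff.1 hopt.1
  constructor
  · intro h
    exact ⟨_, ⟨hfeas.2.1, h⟩, fun i => hfeas.2.2 _ ⟨i, rfl⟩⟩
  · rintro ⟨P, ⟨hP, hPc⟩, hex⟩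
    have := hopt.2 ((optimum C (Set.range ω)).1, P)
      (isFeasible_iff.2 ⟨hfeas.1, hP, by rintro _ ⟨i, rfl⟩; exact hex i⟩)
    rcases cost_le_iff.1 this with h | h
    · exact absurd h (lt_irrefl _)
    · exact h.2.trans hPc

/-- By uniqueness, the optimal matrix lies in a closed set `F` if some matrix of `F` is feasible for
the optimal `γ` with norm at most the optimal one: a closed condition on the samples, the optimal
`γ` and the optimal norm. -/
theorem measurable_optimum (hn : 0 < n) (hC : (n : ℝ) ≤ C) (k : ℕ) :
    Measurable fun ω : Fin k → Sample 𝒜 => optimum C (Set.range ω) := by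
  refine (measurable_optimum_fst hn hC k).prodMk (measurable_of_isClosed fun F hF => ?_)
  have hZ : IsClosed {p : ((Fin k → Sample 𝒜) × ℝ × ℝ) × Matrix (Fin n) (Fin n) ℝ |
      (∀ i, excess (p.1.1 i) p.1.2.1 p.2 ≤ 0) ∧ frobeniusNorm p.2 ^ 2 ≤ p.1.2.2} := by
    refine IsClosed.inter ?_ (isClosed_le
      ((continuous_frobeniusNorm.comp continuous_snd).pow 2)
      (continuous_snd.comp (continuous_snd.comp continuous_fst)))
    exact (isClosed_excess_family (𝒜 := 𝒜) k).preimage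
      (f := fun p : ((Fin k → Sample 𝒜) × ℝ × ℝ) × Matrix (Fin n) (Fin n) ℝ =>
        ((p.1.1, p.1.2.1), p.2)) (by fun_prop)
  have hcl := (isClosed_exists_mem_compact ((isCompact_admissible C).inter_right hF)
    hZ).measurableSet
  have hm : Measurable fun ω : Fin k → Sample 𝒜 => (ω, (optimum C (Set.range ω)).1,
      frobeniusNorm (optimum C (Set.range ω)).2 ^ 2) :=
    measurable_id.prodMk ((measurable_optimum_fst hn hC k).prodMk
      (measurable_frobeniusNorm_optimum hn hC k))
  convert hm hcl using 1
  ext ω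
  have hopt := isOptimal_optimum hn hC (Set.finite_range ω)
  have hfeas := isFeasible_iff.1 hopt.1
  constructor
  · intro h
    exact ⟨_, ⟨hfeas.2.1, h⟩, fun i => hfeas.2.2 _ ⟨i, rfl⟩, le_rfl⟩
  · rintro ⟨P, ⟨hP, hPF⟩, hex, hle⟩
    have hle' : frobeniusNorm P ^ 2 ≤ frobeniusNorm (optimum C (Set.range ω)).2 ^ 2 := hle
    have hcost : cost ((optimum C (Set.range ω)).1, P) ≤ cost (optimum C (Set.range ω)) :=
      cost_le_iff.2 (Or.inr ⟨rfl, hle'⟩)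
    have hP' : IsOptimal C (Set.range ω) ((optimum C (Set.range ω)).1, P) :=
      ⟨isFeasible_iff.2 ⟨hfeas.1, hP, by rintro _ ⟨i, rfl⟩; exact hex i⟩, fun t ht =>
        hcost.trans (hopt.2 t ht)⟩
    have h2 : (optimum C (Set.range ω)).2 = P := congrArg Prod.snd (isOptimal_unique hopt hP')
    change (optimum C (Set.range ω)).2 ∈ F
    rw [h2]
    exact hPF

end Measurability

/-! ### The scenario theorem for the sampled problem -/

section Scenario

variable {n : ℕ} {𝒜 : Finset (Matrix (Fin n) (Fin n) ℝ)} {C : ℝ}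

/-- A smallest set of constraints with the same optimum is irredundant, hence small. -/
theorem exists_small_subset (hn : 0 < n) (hC : (n : ℝ) ≤ C) {ω : Set (Sample 𝒜)}
    (hω : ω.Finite) :
    ∃ ω₀ ⊆ ω, ω₀.ncard ≤ n * (n + 1) / 2 ∧ optimum C ω₀ = optimum C ω := by
  classical
  have hex : ∃ k, ∃ ω₀ ⊆ ω, ω₀.ncard = k ∧ optimum C ω₀ = optimum C ω :=
    ⟨_, ω, subset_rfl, rfl, rfl⟩
  obtain ⟨ω₀, hsub, hcard, hopt⟩ := Nat.find_spec hex
  refine ⟨ω₀, hsub, ?_, hopt⟩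
  have hfin := hω.subset hsub
  refine ncard_le_of_irredundant hn hfin (isOptimal_optimum hn hC hfin)
    (s := fun δ => optimum C (ω₀ \ {δ.1}))
    (fun δ => isOptimal_optimum hn hC (hfin.subset Set.sdiff_subset)) fun δ heq => ?_
  have hlt := Set.ncard_sdiff_singleton_lt_of_mem δ.2 hfin
  rw [hcard] at hlt
  exact Nat.find_min hex hlt ⟨_, Set.sdiff_subset.trans hsub, rfl, heq.trans hopt⟩

/-- The sampled Lyapunov problem satisfies the hypotheses of the scenario bound, with solutions `(γ, P)`
determined by `n (n + 1) / 2` samples. -/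
theorem isSampledProblem_optimum [NeZero n] (hBar : ∀ A ∈ 𝒜, ¬ IsBarabanov A)
    (hC : (n : ℝ) ≤ C) :
    IsSampledProblem (sampleMeasure 𝒜) (n * (n + 1) / 2) (optimum (𝒜 := 𝒜) C)
      {p | excess p.2 p.1.1 p.1.2 ≤ 0} {p | excess p.2 p.1.1 p.1.2 = 0} := by
  have hn : 0 < n := Nat.pos_of_ne_zero (NeZero.ne n)
  have hcont : Continuous fun p : (ℝ × Matrix (Fin n) (Fin n) ℝ) × Sample 𝒜 =>
      excess p.2 p.1.1 p.1.2 :=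
    continuous_excess continuous_snd (continuous_fst.comp continuous_fst)
      (continuous_snd.comp continuous_fst)
  have hopt : ∀ ω : Set (Sample 𝒜), ω.Finite → IsOptimal C ω (optimum C ω) :=
    fun ω hω => isOptimal_optimum hn hC hω
  have hfeas : ∀ ω : Set (Sample 𝒜), ω.Finite → _ := fun ω hω => isFeasible_iff.1 (hopt ω hω).1
  refine ⟨(isClosed_le hcont continuous_const).measurableSet,
    (isClosed_eq hcont continuous_const).measurableSet, measurable_optimum hn hC,
    fun ω hω => (hfeas ω hω).2.2, fun ω ω' hω' hsub hsat => ?_, fun ω hω δ hδ hnt => ?_,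
    fun ω hω => ?_, fun ω hω => exists_small_subset hn hC hω⟩
  · have hω := hω'.subset hsub
    refine isOptimal_unique (hopt ω' hω') ⟨isFeasible_iff.2 ⟨(hfeas ω hω).1, (hfeas ω hω).2.1,
      hsat⟩, fun t ht => (hopt ω hω).2 t ?_⟩
    exact ⟨ht.1, ht.2, ht.3, ht.4, fun δ hδ => ht.5 δ (hsub hδ)⟩
  · exact isOptimal_sdiff_of_not_tight hω (hopt ω hω) (hopt _ (hω.subset Set.sdiff_subset))
      (lt_of_le_of_ne ((hfeas ω hω).2.2 δ hδ) hnt)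
  · have hf := hfeas ω hω
    generalize optimum C ω = s at hf
    have htight := sampleMeasure_tight hBar hf.1 (admissible_posDef hf.2.1)
    exact htight

end Scenario

/-! ### From the violation probability to the joint spectral radius -/

section Bound

/-- If the constraints violated by `(γ, P)` have probability at most `ε`, the directions that a
given mode `A` violates occupy at most the proportion `m ε` of the unit ball. -/
theorem volume_violated_le {n : ℕ} [NeZero n] {𝒜 : Finset (Matrix (Fin n) (Fin n) ℝ)}
    {γ ε : ℝ} {P : Matrix (Fin n) (Fin n) ℝ}
    (hV : (sampleMeasure 𝒜).real {δ | 0 < excess δ γ P} ≤ ε)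
    {A : Matrix (Fin n) (Fin n) ℝ} (hA : A ∈ 𝒜) :
    volume.real ({z : EuclideanSpace ℝ (Fin n) |
        γ ^ 2 * quadForm P z.ofLp < quadForm P (A.mulVec z.ofLp)} ∩ Metric.ball 0 1) ≤
      𝒜.card * ε * volume.real (Metric.ball (0 : EuclideanSpace ℝ (Fin n)) 1) := by
  have hn : 0 < n := Nat.pos_of_ne_zero (NeZero.ne n)
  have : IsProbabilityMeasure (sampleMeasure 𝒜) := isProbabilityMeasure_sampleMeasure ⟨A, hA⟩
  set E : Set (EuclideanSpace ℝ (Fin n)) :=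
    {z | γ ^ 2 * quadForm P z.ofLp < quadForm P (A.mulVec z.ofLp)}
  have hofLp : Continuous fun z : EuclideanSpace ℝ (Fin n) => z.ofLp := PiLp.continuous_ofLp 2 _
  have hE : IsOpen E := isOpen_lt
    (continuous_const.mul (continuous_quadForm continuous_const hofLp))
    (continuous_quadForm continuous_const (continuous_const.matrix_mulVec hofLp))
  have hcone : ∀ c : ℝ, 0 < c → ∀ z, c • z ∈ E ↔ z ∈ E := by
    intro c hc z
    simp only [E, Set.mem_ofPred_eq, WithLp.ofLp_smul, Matrix.mulVec_smul, quadForm_smul_vec]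
    rw [mul_left_comm, mul_lt_mul_iff_right₀ (by positivity)]
  have h := sphereUniform_cone hn hE.measurableSet (by simp [E, quadForm]) hcone
  have hsub : ({⟨A, hA⟩} : Set 𝒜) ×ˢ {x : Sphere n | x.1 ∈ E} ⊆ {δ | 0 < excess δ γ P} := by
    rintro ⟨A', x⟩ ⟨hA', hx⟩
    rw [Set.mem_singleton_iff] at hA'
    subst hA'
    have hx' : γ ^ 2 * quadForm P x.1.ofLp < quadForm P (A.mulVec x.1.ofLp) := hx
    exact sub_pos.2 hx'
  have hprod : (sampleMeasure 𝒜).real (({⟨A, hA⟩} : Set 𝒜) ×ˢ {x : Sphere n | x.1 ∈ E}) =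
      (𝒜.card : ℝ)⁻¹ * (sphereUniform n).real {x : Sphere n | x.1 ∈ E} := by
    rw [measureReal_def, sampleMeasure, Measure.prod_prod, ProbabilityTheory.uniformOn_univ,
      Measure.count_singleton, ENNReal.toReal_mul, one_div, ENNReal.toReal_inv,
      ENNReal.toReal_natCast, Fintype.card_coe, measureReal_def]
  have hle := (measureReal_mono hsub).trans hV
  have hcard : (0 : ℝ) < 𝒜.card := by exact_mod_cast Finset.card_pos.2 ⟨A, hA⟩
  have hball : 0 < volume.real (Metric.ball (0 : EuclideanSpace ℝ (Fin n)) 1) :=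
    ENNReal.toReal_pos (Metric.measure_ball_pos _ _ one_pos).ne' measure_ball_lt_top.ne
  rw [hprod, h, inv_mul_le_iff₀ hcard, div_le_iff₀ hball] at hle
  exact hle

/-- Matrices of size at most `1` are Barabanov. -/
theorem two_le_of_not_isBarabanov {n : ℕ} {A : Matrix (Fin n) (Fin n) ℝ}
    (hA : ¬ IsBarabanov A) : 2 ≤ n := by
  by_contra hn
  have hn' : n ≤ 1 := by omega
  apply hA
  refine ⟨1, Matrix.PosDef.one, ?_⟩
  interval_cases n
  · exact ⟨0, le_rfl, Subsingleton.elim _ _⟩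
  · refine ⟨|A 0 0|, abs_nonneg _, ?_⟩
    ext i j
    rw [Subsingleton.elim i 0, Subsingleton.elim j 0]
    simp [Matrix.mul_apply, sq]

/-- The deterministic part of the bound: a pair `(γ, P)` violated with probability at most `ε`
bounds the joint spectral radius, whether or not it is an optimum. -/
theorem jointSpectralRadius_le_of_violation {n : ℕ} (hn : 2 ≤ n)
    {𝒜 : Finset (Matrix (Fin n) (Fin n) ℝ)} {γ ε : ℝ} (hγ : 0 ≤ γ) (hε : 0 ≤ ε)
    {P : Matrix (Fin n) (Fin n) ℝ} (hP : P.PosDef)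
    (hV : (sampleMeasure 𝒜).real {δ | 0 < excess δ γ P} ≤ ε)
    (hlt : (𝒜.card : ℝ) * ε * kappa P < 1) {d : ℕ} (hd : n ≤ d) :
    jointSpectralRadius 𝒜 ≤
      γ / √(1 - regIncBetaInv ((𝒜.card : ℝ) * ε * kappa P) (((d : ℝ) - 1) / 2) (1 / 2)) := by
  obtain ⟨m, rfl⟩ : ∃ m, n = m + 2 := ⟨n - 2, by omega⟩
  obtain ⟨q, rfl⟩ : ∃ q, d = q + 2 := ⟨d - 2, by omega⟩
  have hq : (((q + 2 : ℕ) : ℝ) - 1) / 2 = ((q : ℝ) + 1) / 2 := by push_cast; ring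
  rw [hq]
  obtain ⟨B, rfl⟩ := exists_transpose_mul_self_eq hP.posSemidef
  have hkappa : 0 ≤ kappa (B.transpose * B) := Real.sqrt_nonneg _
  have hB : IsUnit B.det := by
    have := hP.det_pos
    rw [Matrix.det_mul, Matrix.det_transpose] at this
    exact isUnit_iff_ne_zero.2 fun h => by simp [h] at this
  refine jointSpectralRadius_le_of_conj hB (by positivity) fun A hA => ?_
  refine norm_conj_le_of_cone_small (by omega) hP hγ ⟨by positivity, hlt⟩ ?_
  refine (mul_le_mul_of_nonneg_left (volume_violated_le hV hA) hkappa).trans_eq ?_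
  ring

end Bound

end JSR

theorem mainTheorem3 (n : ℕ) (𝒜 : Finset (Matrix (Fin n) (Fin n) ℝ)) (h𝒜 : 𝒜.Nonempty)
    (hBar : ∀ A ∈ 𝒜, ¬ JSR.IsBarabanov A)
    (C : ℝ) (hC : (n : ℝ) ≤ C)
    (d : ℕ) (hd : d = n * (n + 1) / 2)
    (N : ℕ) (hN : d ≤ N) (ε : ℝ) (hε : ε ∈ Set.Ioo (0 : ℝ) 1) :
    (∀ ω : Fin N → JSR.Sample 𝒜, ∃! s, JSR.IsOptimal C (Set.range ω) s) ∧
    ∃ Ω : Set (Fin N → JSR.Sample 𝒜), MeasurableSet Ω ∧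
      MeasureTheory.Measure.pi (fun _ : Fin N => JSR.sampleMeasure 𝒜) Ω ≤
        ENNReal.ofReal (JSR.Phi ε (d - 1) N) ∧
      ∀ ω ∉ Ω, ∀ γ P, JSR.IsOptimal C (Set.range ω) (γ, P) →
        (𝒜.card : ℝ) * ε * JSR.kappa P < 1 →
        JSR.jointSpectralRadius 𝒜 ≤
          γ / √(1 - JSR.regIncBetaInv ((𝒜.card : ℝ) * ε * JSR.kappa P)
            (((d : ℝ) - 1) / 2) (1 / 2)) := by
  obtain ⟨A₀, hA₀⟩ := h𝒜
  have hn2 : 2 ≤ n := JSR.two_le_of_not_isBarabanov (hBar A₀ hA₀)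
  have hn : 0 < n := by omega
  have : NeZero n := ⟨hn.ne'⟩
  have : IsProbabilityMeasure (JSR.sampleMeasure 𝒜) :=
    JSR.isProbabilityMeasure_sampleMeasure ⟨A₀, hA₀⟩
  have hnd : n ≤ d := by
    rw [hd, Nat.le_div_iff_mul_le two_pos]
    exact Nat.mul_le_mul_left n (by omega)
  have hprob := JSR.isSampledProblem_optimum hBar hC
  rw [← hd] at hprob
  refine ⟨fun ω => ⟨_, JSR.isOptimal_optimum hn hC (Set.finite_range ω), fun s hs =>
    JSR.isOptimal_unique hs (JSR.isOptimal_optimum hn hC (Set.finite_range ω))⟩, _, ?_,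
    hprob.pi_low_sat_le (by omega) hN hε, ?_⟩
  · exact measurableSet_lt ((measurable_measure_prodMk_left hprob.measurableSet_sat).comp
      (hprob.measurable_sol N)).ennreal_toReal measurable_const
  · intro ω hω γ P hopt hlt
    have hfeas := JSR.isFeasible_iff.1 hopt.1
    refine JSR.jointSpectralRadius_le_of_violation hn2 hfeas.1 hε.1.le
      (JSR.admissible_posDef hfeas.2.1) ?_ hlt hnd
    have heq := JSR.isOptimal_unique (JSR.isOptimal_optimum hn hC (Set.finite_range ω)) hopt
    have hsat := not_lt.1 (Set.notMem_ofPred_iff.1 hω)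
    rw [heq] at hsat
    have hmeas : MeasurableSet {δ : JSR.Sample 𝒜 | JSR.excess δ γ P ≤ 0} :=
      measurable_prodMk_left (x := (γ, P)) hprob.measurableSet_sat
    have hcompl : {δ : JSR.Sample 𝒜 | 0 < JSR.excess δ γ P} =
        {δ : JSR.Sample 𝒜 | JSR.excess δ γ P ≤ 0}ᶜ := by
      ext δ
      simp
    have hsat' : 1 - ε ≤ (JSR.sampleMeasure 𝒜).real {δ | JSR.excess δ γ P ≤ 0} := hsat
    rw [hcompl, probReal_compl_eq_one_sub hmeas]
    linarith
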